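/- Let $n\ge 0$ and let $A\in\mathbb{Q}^{n\times n}$ be expanding, i.e. every complex eigenvalue $\eta$ of $A$ satisfies $|\eta|>1$; put $B=A^{-1}$. For an invertible $M\in\mathbb{Q}^{n\times n}$ let $\mathbb{Z}^n[M]=\sum_{k\ge 0}M^k\mathbb{Z}^n\subset\mathbb{Q}^n$, and let $\mathbb{Z}^n(B)=\sum_{k\in\mathbb{Z}}B^k\mathbb{Z}^n$. Set $b=|\mathbb{Z}^n[B]/B\mathbb{Z}^n[B]|$. For $y\in\mathbb{Z}^n(B)$ let $\nu(y)$ be the integer $k$ with $y\in B^k\mathbb{Z}^n[B]\setminus B^{k+1}\mathbb{Z}^n[B]$, and $\nu(y)=\infty$ if there is no such $k$ (in particular $\nu(0)=\infty$). Let $\mathbb{Z}^n((B))$ be the (Hausdorff) completion of $\mathbb{Z}^n(B)$ with respect to $\mathbf{d}_B(y,y')=b^{-\nu(y-y')}$, where $b^{-\infty}=0$ and points at distance $0$ are identified. Extend $\mathbf{d}_B$ to it, let $\mathbb{Z}^n[[B]]=\{y\in\mathbb{Z}^n((B)) : \mathbf{d}_B(y,0)\le 1\}$, and let $\mu_B$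 be the Haar measure on $\mathbb{Z}^n((B))$ with $\mu_B(\mathbb{Z}^n[[B]])=1$. Let $\mathbb{K}_A=\mathbb{R}^n\times\mathbb{Z}^n((B))$, with the measure $\mu=\lambda\times\mu_B$, where $\lambda$ is Lebesgue measure. The matrix $A$ acts on $\mathbb{K}_A$ by multiplication in both coordinates (extended by continuity in the second), and $\varphi:\mathbb{Z}^n(B)\to\mathbb{K}_A$, $\varphi(x)=(x,x)$, is the diagonal map. Let $\mathcal{D}\subset\mathbb{Z}^n[A]$ be a finite set with $|\mathcal{D}|=|\mathbb{Z}^n[A]/A\mathbb{Z}^n[A]|$, and suppose that $(A,\mathcal{D})$ is a standard digit system, i.e. $\mathcal{D}$ is a complete set of residue class representatives of $\mathbb{Z}^n[A]/A\mathbb{Z}^n[A]$. Then there is a unique nonempty compact set $\mathcal{F}=\mathcal{F}(A,\mathcal{D})\subset\mathbb{K}_A$ with $$A\mathcal{F}=\bigcup_{d\in\mathcal{D}}(\mathcal{F}+\varphi(d)),$$ and $\mu(\mathcal{F})>0$; that is, $\mathcal{F}$ is a rational self-affine tile. -/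

import Mathlib

open MeasureTheory

namespace RationalTile

variable {n : ℕ}

/-- All complex eigenvalues of `A` lie outside the closed unit disk. -/
def IsExpanding (A : Matrix (Fin n) (Fin n) ℚ) : Prop :=
  ∀ z ∈ spectrum ℂ (A.map (algebraMap ℚ ℂ)), 1 < ‖z‖

/-- The group `ℤⁿ`, as a subgroup of `ℚⁿ`. -/
def intLattice (n : ℕ) : AddSubgroup (Fin n → ℚ) :=
  ((Int.castAddHom ℚ).compLeft (Fin n)).range

/-- Multiplication by the matrix `M` on `ℚⁿ`. -/
def mulHom (M : Matrix (Fin n) (Fin n) ℚ) : (Fin n → ℚ) →+ (Fin n → ℚ) :=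
  M.mulVecLin.toAddMonoidHom

/-- The module `ℤⁿ[M]`, the sum of all `M ^ k ℤⁿ` with `k ≥ 0`. -/
def zAdjoin (M : Matrix (Fin n) (Fin n) ℚ) : AddSubgroup (Fin n → ℚ) :=
  ⨆ k : ℕ, (intLattice n).map (mulHom (M ^ k))

/-- The submodule `M ℤⁿ[M]` of `ℤⁿ[M]`. -/
def mulSub (M : Matrix (Fin n) (Fin n) ℚ) : AddSubgroup (zAdjoin M) :=
  ((zAdjoin M).map (mulHom M)).addSubgroupOf (zAdjoin M)

/-- The order of `ℤⁿ[M] / M ℤⁿ[M]`. -/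
noncomputable def residueCard (M : Matrix (Fin n) (Fin n) ℚ) : ℕ :=
  Nat.card (zAdjoin M ⧸ mulSub M)

/-- `(A, D)` is a digit system: `A` is expanding and `D ⊆ ℤⁿ[A]` has as many elements as
`ℤⁿ[A] / A ℤⁿ[A]`. -/
structure IsDigitSystem (A : Matrix (Fin n) (Fin n) ℚ) (D : Finset (zAdjoin A)) : Prop where
  expanding : IsExpanding A
  card_eq : D.card = residueCard A

/-- A digit system is standard if every residue class of `ℤⁿ[A]` modulo `A ℤⁿ[A]` has exactly one
representative in `D`. -/
structure IsStandardDigitSystem (A : Matrix (Fin n) (Fin n) ℚ) (D : Finset (zAdjoin A)) : Prop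
    extends IsDigitSystem A D where
  complete : ∀ c : zAdjoin A ⧸ mulSub A, ∃! d : zAdjoin A, d ∈ D ∧ QuotientAddGroup.mk d = c

/-- The module `ℤⁿ(B) = ℤⁿ(A)`, the sum of all `A ^ k ℤⁿ` with `k ∈ ℤ`. -/
noncomputable def zLaurent (A : Matrix (Fin n) (Fin n) ℚ) : AddSubgroup (Fin n → ℚ) :=
  ⨆ k : ℤ, (intLattice n).map (mulHom (A ^ k))

/-- The module `B ^ k ℤⁿ[B]`, where `B = A⁻¹` and `k ∈ ℤ`. -/
noncomputable def filt (A : Matrix (Fin n) (Fin n) ℚ) (k : ℤ) : AddSubgroup (Fin n → ℚ) :=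
  (zAdjoin A⁻¹).map (mulHom (A⁻¹ ^ k))

/-- `B ^ k ℤⁿ[B]` contains `y` and `B ^ (k + 1) ℤⁿ[B]` does not. -/
def IsJump (A : Matrix (Fin n) (Fin n) ℚ) (y : Fin n → ℚ) (k : ℤ) : Prop :=
  y ∈ filt A k ∧ y ∉ filt A (k + 1)

open Classical in
/-- The `B`-adic valuation. The value is `⊤` at the points of `ℤⁿ(B)` that lie in `B ^ k ℤⁿ[B]`
for every `k`. -/
noncomputable def val (A : Matrix (Fin n) (Fin n) ℚ) (y : Fin n → ℚ) : WithTop ℤ :=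
  if ∃ k, IsJump A y k then ((sInf {k : ℤ | IsJump A y k} : ℤ) : WithTop ℤ) else ⊤

/-- `b ^ (-v)` for `b = |ℤⁿ[B] / B ℤⁿ[B]|`, with the convention `b ^ (-∞) = 0`. -/
noncomputable def expVal (A : Matrix (Fin n) (Fin n) ℚ) : WithTop ℤ → ℝ
  | ⊤ => 0
  | (k : ℤ) => (residueCard A⁻¹ : ℝ) ^ (-k)

/-- `b ^ (-ν(y))`. -/
noncomputable def bAbs (A : Matrix (Fin n) (Fin n) ℚ) (y : Fin n → ℚ) : ℝ :=
  expVal A (val A y)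

/-! Basic facts needed to know that `bAbs` is a seminorm whose unit ball is precompact. -/

theorem mulHom_comp (M N : Matrix (Fin n) (Fin n) ℚ) (x : Fin n → ℚ) :
    mulHom M (mulHom N x) = mulHom (M * N) x := by
  simp [mulHom]

theorem mulHom_one (x : Fin n → ℚ) : mulHom (1 : Matrix (Fin n) (Fin n) ℚ) x = x := by
  simp [mulHom]

theorem IsExpanding.isUnit_det {A : Matrix (Fin n) (Fin n) ℚ} (hA : IsExpanding A) :
    IsUnit A.det := by
  have h0 : (0 : ℂ) ∉ spectrum ℂ (A.map (algebraMap ℚ ℂ)) := by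
    intro h
    have := hA 0 h
    norm_num at this
  rw [spectrum.zero_notMem_iff, Matrix.isUnit_iff_isUnit_det] at h0
  have h1 : (A.map (algebraMap ℚ ℂ)).det = algebraMap ℚ ℂ A.det := by
    rw [RingHom.map_det]; rfl
  rw [h1, isUnit_iff_ne_zero] at h0
  rw [isUnit_iff_ne_zero]
  rintro h
  exact h0 (by rw [h, map_zero])

theorem intLattice_le_zAdjoin (M : Matrix (Fin n) (Fin n) ℚ) : intLattice n ≤ zAdjoin M := by
  intro x hx
  refine AddSubgroup.mem_iSup_of_mem 0 ⟨x, hx, ?_⟩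
  rw [pow_zero, mulHom_one]

theorem map_zAdjoin_le (M : Matrix (Fin n) (Fin n) ℚ) :
    (zAdjoin M).map (mulHom M) ≤ zAdjoin M := by
  rw [zAdjoin, AddSubgroup.map_iSup]
  refine iSup_le fun k => ?_
  rintro _ ⟨_, ⟨x, hx, rfl⟩, rfl⟩
  refine AddSubgroup.mem_iSup_of_mem (k + 1) ⟨x, hx, ?_⟩
  rw [mulHom_comp, pow_succ']

section
variable {A : Matrix (Fin n) (Fin n) ℚ}

theorem isUnit_inv_det (h : IsUnit A.det) : IsUnit (A⁻¹).det :=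
  Matrix.isUnit_nonsing_inv_det A h

theorem filt_zero : filt A 0 = zAdjoin A⁻¹ := by
  ext x
  constructor
  · rintro ⟨y, hy, rfl⟩
    rw [zpow_zero, mulHom_one]
    exact hy
  · intro hx
    exact ⟨x, hx, by rw [zpow_zero, mulHom_one]⟩

theorem map_filt (h : IsUnit A.det) (j k : ℤ) :
    (filt A k).map (mulHom (A⁻¹ ^ j)) = filt A (j + k) := by
  rw [filt, filt, AddSubgroup.map_map]
  congr 1
  refine AddMonoidHom.ext fun x => ?_
  rw [AddMonoidHom.comp_apply, mulHom_comp]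
  rw [Matrix.zpow_add (isUnit_inv_det h)]

theorem filt_succ_le (h : IsUnit A.det) (k : ℤ) : filt A (k + 1) ≤ filt A k := by
  rw [← map_filt h k 1, filt, filt, zpow_one]
  exact AddSubgroup.map_mono (map_zAdjoin_le _)

theorem filt_antitone (h : IsUnit A.det) : Antitone (filt A) :=
  antitone_int_of_succ_le (filt_succ_le h)

theorem exists_mem_filt (h : IsUnit A.det) {y : Fin n → ℚ} (hy : y ∈ zLaurent A) :
    ∃ k, y ∈ filt A k := by
  have hd : Directed (· ≤ ·) fun k : ℤ => filt A (-k) :=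
    Monotone.directed_le fun a b hab => filt_antitone h (by lia)
  have hle : zLaurent A ≤ ⨆ k : ℤ, filt A (-k) := by
    refine iSup_le fun k => ?_
    rintro _ ⟨x, hx, rfl⟩
    refine AddSubgroup.mem_iSup_of_mem k ⟨x, intLattice_le_zAdjoin _ hx, ?_⟩
    rw [Matrix.inv_zpow' h, neg_neg]
  obtain ⟨k, hk⟩ := (AddSubgroup.mem_iSup_of_directed hd).1 (hle hy)
  exact ⟨_, hk⟩

theorem mem_filt_of_no_jump (h : IsUnit A.det) {y : Fin n → ℚ} (hy : y ∈ zLaurent A)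
    (hj : ¬ ∃ k, IsJump A y k) (k : ℤ) : y ∈ filt A k := by
  obtain ⟨m, hm⟩ := exists_mem_filt h hy
  have key : ∀ i : ℕ, y ∈ filt A (m + i) := by
    intro i
    induction i with
    | zero => simpa using hm
    | succ i ih =>
      by_contra hc
      exact hj ⟨m + i, ih, by rwa [add_assoc, ← Nat.cast_succ]⟩
  exact filt_antitone h (show k ≤ m + ((k - m).toNat : ℤ) by lia) (key _)

theorem isJump_unique (h : IsUnit A.det) {y : Fin n → ℚ} {j k : ℤ} (hj : IsJump A y j)
    (hk : IsJump A y k) : j = k := by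
  apply le_antisymm
  · by_contra hc
    exact hk.2 (filt_antitone h (by lia) hj.1)
  · by_contra hc
    exact hj.2 (filt_antitone h (by lia) hk.1)

theorem val_of_isJump (h : IsUnit A.det) {y : Fin n → ℚ} {k : ℤ} (hk : IsJump A y k) :
    val A y = (k : WithTop ℤ) := by
  have hs : {j : ℤ | IsJump A y j} = {k} :=
    Set.eq_singleton_iff_unique_mem.2 ⟨hk, fun j hj => isJump_unique h hj hk⟩
  rw [val, if_pos ⟨k, hk⟩, hs, csInf_singleton]

theorem bAbs_of_isJump (h : IsUnit A.det) {y : Fin n → ℚ} {k : ℤ} (hk : IsJump A y k) :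
    bAbs A y = (residueCard A⁻¹ : ℝ) ^ (-k) := by
  rw [bAbs, val_of_isJump h hk]
  rfl

theorem bAbs_of_no_jump {y : Fin n → ℚ} (hj : ¬ ∃ k, IsJump A y k) : bAbs A y = 0 := by
  rw [bAbs, val, if_neg hj]
  rfl

theorem finite_residue (M : Matrix (Fin n) (Fin n) ℚ) (hM : IsUnit M.det) :
    Finite (zAdjoin M ⧸ mulSub M) := by
  obtain ⟨m, hm0, hm⟩ : ∃ m : ℕ, m ≠ 0 ∧
      ∀ x ∈ intLattice n, m • mulHom M⁻¹ x ∈ intLattice n := by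
    refine ⟨∏ i, ∏ j, (M⁻¹ i j).den, Finset.prod_ne_zero_iff.2 fun i _ =>
      Finset.prod_ne_zero_iff.2 fun j _ => (M⁻¹ i j).den_ne_zero, ?_⟩
    rintro _ ⟨v, rfl⟩
    set m := ∏ i, ∏ j, (M⁻¹ i j).den with hmdef
    have hint : ∀ i j, ∃ z : ℤ, (m : ℚ) * M⁻¹ i j = z := by
      intro i j
      obtain ⟨c, hc⟩ : (M⁻¹ i j).den ∣ m :=
        (Finset.dvd_prod_of_mem _ (Finset.mem_univ j)).trans
          (Finset.dvd_prod_of_mem (fun i => ∏ j, (M⁻¹ i j).den) (Finset.mem_univ i))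
      refine ⟨c * (M⁻¹ i j).num, ?_⟩
      rw [hc]
      push_cast
      rw [mul_comm ((M⁻¹ i j).den : ℚ), mul_assoc, mul_comm ((M⁻¹ i j).den : ℚ),
        Rat.mul_den_eq_num]
    choose z hz using hint
    refine ⟨fun i => ∑ j, z i j * v j, ?_⟩
    ext i
    simp only [mulHom, AddMonoidHom.compLeft_apply, Function.comp, Pi.smul_apply, nsmul_eq_mul,
      LinearMap.toAddMonoidHom_coe, Matrix.mulVecLin_apply, Matrix.mulVec, dotProduct]
    simp only [Int.coe_castAddHom, Int.cast_sum, Int.cast_mul, Finset.mul_sum]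
    refine Finset.sum_congr rfl fun j _ => ?_
    rw [← hz]
    simp [mul_assoc]
  have : NeZero m := ⟨hm0⟩
  let toZ : (Fin n → ℤ) → zAdjoin M := fun v =>
    ⟨(Int.castAddHom ℚ).compLeft (Fin n) v, intLattice_le_zAdjoin M ⟨v, rfl⟩⟩
  have hsmul : ∀ x ∈ intLattice n, m • x ∈ (zAdjoin M).map (mulHom M) := by
    intro x hx
    refine ⟨m • mulHom M⁻¹ x, intLattice_le_zAdjoin M (hm x hx), ?_⟩
    rw [map_nsmul, mulHom_comp, Matrix.mul_nonsing_inv _ hM, mulHom_one]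
  have hsurj : Function.Surjective fun w : Fin n → Fin m =>
      (QuotientAddGroup.mk (toZ fun i => ((w i : ℕ) : ℤ)) : zAdjoin M ⧸ mulSub M) := by
    intro q
    obtain ⟨⟨x, hx⟩, rfl⟩ := QuotientAddGroup.mk_surjective q
    have h1 : ∃ y ∈ intLattice n, x - y ∈ (zAdjoin M).map (mulHom M) := by
      have hx' := hx
      rw [zAdjoin] at hx'
      refine AddSubgroup.iSup_induction _
        (C := fun x => ∃ y ∈ intLattice n, x - y ∈ (zAdjoin M).map (mulHom M)) hx' ?_ ?_ ?_
      · rintro k _ ⟨x, hx, rfl⟩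
        cases k with
        | zero =>
          refine ⟨x, hx, ?_⟩
          rw [pow_zero, mulHom_one, sub_self]
          exact zero_mem _
        | succ k =>
          refine ⟨0, zero_mem _, mulHom (M ^ k) x,
            AddSubgroup.mem_iSup_of_mem k ⟨x, hx, rfl⟩, ?_⟩
          rw [mulHom_comp, pow_succ', sub_zero]
      · exact ⟨0, zero_mem _, by rw [sub_self]; exact zero_mem _⟩
      · rintro x x' ⟨y, hy, hxy⟩ ⟨y', hy', hxy'⟩
        exact ⟨y + y', add_mem hy hy', by
          rw [add_sub_add_comm]; exact add_mem hxy hxy'⟩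
    obtain ⟨_, ⟨v, rfl⟩, hv⟩ := h1
    have hmpos : (0 : ℤ) < m := by exact_mod_cast Nat.pos_of_ne_zero hm0
    refine ⟨fun i => ⟨(v i % m).toNat, by
      have := Int.emod_lt_of_pos (v i) hmpos
      have := Int.emod_nonneg (v i) hmpos.ne'
      lia⟩, ?_⟩
    refine QuotientAddGroup.eq.2 ?_
    change -((Int.castAddHom ℚ).compLeft (Fin n) _) + x ∈ (zAdjoin M).map (mulHom M)
    have h2 := hsmul _ ⟨fun i => v i / m, rfl⟩
    have h3 := add_mem hv h2
    convert h3 using 1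
    ext i
    have h4 := Int.emod_nonneg (v i) hmpos.ne'
    have h5 : (v i : ℚ) = (v i % m : ℤ) + m * (v i / m : ℤ) := by
      exact_mod_cast (Int.emod_add_mul_ediv (v i) m).symm
    have h6 : (m • ((Int.castAddHom ℚ).compLeft (Fin n) fun i => v i / (m : ℤ))) i =
        (m : ℚ) * (v i / (m : ℤ) : ℤ) := by
      rw [Pi.smul_apply, nsmul_eq_mul]
      rfl
    rw [Pi.add_apply, Pi.add_apply, h6]
    simp only [AddMonoidHom.compLeft_apply, Function.comp, Pi.neg_apply,
      Pi.sub_apply, Int.coe_castAddHom, Int.toNat_of_nonneg h4]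
    rw [h5]
    ring
  exact Finite.of_surjective _ hsurj

theorem one_le_residueCard (M : Matrix (Fin n) (Fin n) ℚ) (hM : IsUnit M.det) :
    1 ≤ residueCard M := by
  have := finite_residue M hM
  exact Nat.card_pos

theorem relIndex_filt_one : (filt A 1).relIndex (filt A 0) = residueCard A⁻¹ := by
  rw [filt_zero, filt, zpow_one]
  rfl

theorem relIndex_filt (h : IsUnit A.det) (k : ℤ) :
    (filt A (k + 1)).relIndex (filt A k) = residueCard A⁻¹ := by
  have hinj : Function.Injective (mulHom (A⁻¹ ^ k)) :=
    Matrix.mulVec_injective_of_isUnit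
      ((Matrix.isUnit_iff_isUnit_det _).2 ((isUnit_inv_det h).det_zpow k))
  rw [← map_filt h k 1]
  conv_lhs => rw [← add_zero k, ← map_filt h k 0]
  rw [add_zero, AddSubgroup.relIndex_map_map_of_injective _ _ hinj, relIndex_filt_one]

theorem relIndex_filt_ne_zero (h : IsUnit A.det) (k : ℕ) :
    (filt A (k : ℤ)).relIndex (filt A 0) ≠ 0 := by
  induction k with
  | zero => simp
  | succ k ih =>
    have h1 := AddSubgroup.relIndex_mul_relIndex (filt A ((k : ℤ) + 1)) (filt A k) (filt A 0)
      (filt_succ_le h k) (filt_antitone h (by lia))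
    rw [Nat.cast_succ, ← h1, relIndex_filt h]
    exact mul_ne_zero (Nat.one_le_iff_ne_zero.1 (one_le_residueCard _ (isUnit_inv_det h))) ih

theorem two_le_of_isJump (h : IsUnit A.det) {y : Fin n → ℚ} {k : ℤ} (hk : IsJump A y k) :
    2 ≤ residueCard A⁻¹ := by
  have h1 := one_le_residueCard _ (isUnit_inv_det h)
  by_contra hc
  have h2 := relIndex_filt h k
  rw [show residueCard A⁻¹ = 1 by lia, AddSubgroup.relIndex_eq_one] at h2
  exact hk.2 (h2 hk.1)

theorem bAbs_nonneg (y : Fin n → ℚ) : 0 ≤ bAbs A y := by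
  unfold bAbs
  cases val A y with
  | top => exact le_rfl
  | coe k => exact zpow_nonneg (Nat.cast_nonneg _) _

theorem bAbs_le_iff (h : IsUnit A.det) {y : Fin n → ℚ} (hy : y ∈ zLaurent A) (k : ℤ) :
    bAbs A y ≤ (residueCard A⁻¹ : ℝ) ^ (-k) ↔ y ∈ filt A k := by
  by_cases hj : ∃ m, IsJump A y m
  · obtain ⟨m, hm⟩ := hj
    have hb := two_le_of_isJump h hm
    rw [bAbs_of_isJump h hm, zpow_le_zpow_iff_right₀ (by exact_mod_cast hb), neg_le_neg_iff]
    constructor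
    · intro hkm
      exact filt_antitone h hkm hm.1
    · intro hk
      by_contra hc
      exact hm.2 (filt_antitone h (by lia) hk)
  · rw [bAbs_of_no_jump hj]
    exact ⟨fun _ => mem_filt_of_no_jump h hy hj k, fun _ => zpow_nonneg (Nat.cast_nonneg _) _⟩

theorem bAbs_zero : bAbs A 0 = 0 :=
  bAbs_of_no_jump fun ⟨_, hk⟩ => hk.2 (zero_mem _)

theorem bAbs_neg (y : Fin n → ℚ) : bAbs A (-y) = bAbs A y := by
  have : ∀ k, IsJump A (-y) k ↔ IsJump A y k := fun k => by simp [IsJump]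
  have h2 : IsJump A (-y) = IsJump A y := funext fun k => propext (this k)
  rw [bAbs, bAbs, val, val, h2]

theorem bAbs_add_le_max (h : IsUnit A.det) {x y : Fin n → ℚ} (hx : x ∈ zLaurent A)
    (hy : y ∈ zLaurent A) : bAbs A (x + y) ≤ max (bAbs A x) (bAbs A y) := by
  by_cases hj : ∃ m : ℤ, max (bAbs A x) (bAbs A y) = (residueCard A⁻¹ : ℝ) ^ (-m)
  · obtain ⟨m, hm⟩ := hj
    rw [hm, bAbs_le_iff h (add_mem hx hy)]
    exact add_mem ((bAbs_le_iff h hx m).1 (hm ▸ le_max_left _ _))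
      ((bAbs_le_iff h hy m).1 (hm ▸ le_max_right _ _))
  · have hx' : ¬ ∃ m, IsJump A x m := by
      rintro ⟨m, hm⟩
      by_cases hy' : ∃ m, IsJump A y m
      · obtain ⟨l, hl⟩ := hy'
        rcases max_choice (bAbs A x) (bAbs A y) with hc | hc
        · exact hj ⟨m, hc.trans (bAbs_of_isJump h hm)⟩
        · exact hj ⟨l, hc.trans (bAbs_of_isJump h hl)⟩
      · refine hj ⟨m, ?_⟩
        rw [bAbs_of_no_jump hy', max_eq_left (bAbs_nonneg x), bAbs_of_isJump h hm]
    have hy' : ¬ ∃ m, IsJump A y m := by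
      rintro ⟨m, hm⟩
      refine hj ⟨m, ?_⟩
      rw [bAbs_of_no_jump hx', max_eq_right (bAbs_nonneg y), bAbs_of_isJump h hm]
    rw [bAbs_of_no_jump]
    · exact le_max_of_le_left (bAbs_nonneg x)
    · rintro ⟨m, hm⟩
      exact hm.2 (add_mem (mem_filt_of_no_jump h hx hx' _) (mem_filt_of_no_jump h hy hy' _))

theorem bAbs_le_one_of_lt_two (h : IsUnit A.det) {y : Fin n → ℚ}
    (h2 : bAbs A y < 2) : bAbs A y ≤ 1 := by
  by_cases hj : ∃ m, IsJump A y m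
  · obtain ⟨m, hm⟩ := hj
    have hb : (2 : ℝ) ≤ residueCard A⁻¹ := by exact_mod_cast two_le_of_isJump h hm
    rw [bAbs_of_isJump h hm] at h2 ⊢
    refine zpow_le_one_of_nonpos₀ (by linarith) ?_
    by_contra hc
    have := zpow_le_zpow_right₀ (show (1 : ℝ) ≤ residueCard A⁻¹ by linarith)
      (show (1 : ℤ) ≤ -m by lia)
    rw [zpow_one] at this
    linarith
  · rw [bAbs_of_no_jump hj]
    exact zero_le_one

theorem bAbs_mul (h : IsUnit A.det) (y : Fin n → ℚ) :
    bAbs A (mulHom A y) = residueCard A⁻¹ * bAbs A y := by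
  have hmem : ∀ k, mulHom A y ∈ filt A k ↔ y ∈ filt A (k + 1) := by
    intro k
    have h1 : (filt A (k + 1)).map (mulHom (A⁻¹ ^ (-1 : ℤ))) = filt A k := by
      rw [map_filt h]; congr 1; ring
    have h2 : A⁻¹ ^ (-1 : ℤ) = A := by
      rw [Matrix.inv_zpow' h, neg_neg, zpow_one]
    rw [h2] at h1
    have hinj : Function.Injective (mulHom A) :=
      Matrix.mulVec_injective_of_isUnit ((Matrix.isUnit_iff_isUnit_det _).2 h)
    rw [← h1, AddSubgroup.mem_map_iff_mem hinj]
  have hJ : ∀ k, IsJump A (mulHom A y) k ↔ IsJump A y (k + 1) := fun k => by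
    rw [IsJump, IsJump, hmem, hmem]
  by_cases hj : ∃ m, IsJump A y m
  · obtain ⟨m, hm⟩ := hj
    have hb := two_le_of_isJump h hm
    have hb0 : (residueCard A⁻¹ : ℝ) ≠ 0 := by
      have : residueCard A⁻¹ ≠ 0 := by lia
      exact_mod_cast this
    rw [bAbs_of_isJump h hm, bAbs_of_isJump h ((hJ (m - 1)).2 (by simpa using hm)),
      ← zpow_one_add₀ hb0]
    congr 1
    ring
  · rw [bAbs_of_no_jump hj, bAbs_of_no_jump, mul_zero]
    rintro ⟨m, hm⟩
    exact hj ⟨_, (hJ m).1 hm⟩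

end

/-- `ℤⁿ(B)`, to be equipped with the `B`-adic metric (and not with the one of `ℚⁿ`). -/
def Laurent (A : Matrix (Fin n) (Fin n) ℚ) (_hA : IsExpanding A) : Type := zLaurent A

section
variable (A : Matrix (Fin n) (Fin n) ℚ) (hA : IsExpanding A)

noncomputable instance : AddCommGroup (Laurent A hA) :=
  inferInstanceAs (AddCommGroup (zLaurent A))

/-- The function `y ↦ b ^ (-ν(y))` on `ℤⁿ(B)`. -/
noncomputable def bSeminorm : AddGroupSeminorm (Laurent A hA) where
  toFun y := bAbs A y.1
  map_zero' := bAbs_zero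
  add_le' x y := (bAbs_add_le_max hA.isUnit_det x.2 y.2).trans
    (max_le_add_of_nonneg (bAbs_nonneg _) (bAbs_nonneg _))
  neg' y := bAbs_neg y.1

/-- The `B`-adic metric `d(y, y') = b ^ (-ν(y - y'))` on `ℤⁿ(B)`. -/
noncomputable instance : SeminormedAddCommGroup (Laurent A hA) :=
  (bSeminorm A hA).toSeminormedAddCommGroup

theorem norm_def (y : Laurent A hA) : ‖y‖ = bAbs A y.1 := rfl

theorem dist_def (y y' : Laurent A hA) : dist y y' = expVal A (val A (y.1 - y'.1)) := by
  rw [dist_eq_norm, norm_def]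
  rfl

/-- The space `ℤⁿ((B))` of `B`-adic series: the completion of `ℤⁿ(B)` for the `B`-adic metric
(points at distance `0` are identified). -/
abbrev BSeries : Type := UniformSpace.Completion (Laurent A hA)

noncomputable instance : MeasurableSpace (BSeries A hA) := borel _

instance : BorelSpace (BSeries A hA) := ⟨rfl⟩

theorem mulHom_mem_zLaurent (h : IsUnit A.det) {y : Fin n → ℚ} (hy : y ∈ zLaurent A) :
    mulHom A y ∈ zLaurent A := by
  have : (zLaurent A).map (mulHom A) ≤ zLaurent A := by
    rw [zLaurent, AddSubgroup.map_iSup]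
    refine iSup_le fun k => ?_
    rintro _ ⟨_, ⟨x, hx, rfl⟩, rfl⟩
    refine AddSubgroup.mem_iSup_of_mem (1 + k) ⟨x, hx, ?_⟩
    rw [mulHom_comp, Matrix.zpow_one_add h]
  exact this ⟨y, hy, rfl⟩

/-- Multiplication by `A` on `ℤⁿ(B)`. -/
noncomputable def laurentMul : Laurent A hA →+ Laurent A hA where
  toFun y := ⟨mulHom A y.1, mulHom_mem_zLaurent A hA.isUnit_det y.2⟩
  map_zero' := Subtype.ext (map_zero (mulHom A))
  map_add' x y := Subtype.ext (map_add (mulHom A) x.1 y.1)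

theorem laurentMul_continuous : Continuous (laurentMul A hA) :=
  AddMonoidHomClass.continuous_of_bound (laurentMul A hA) (residueCard A⁻¹ : ℝ) fun y =>
    (bAbs_mul hA.isUnit_det y.1).le

/-- Multiplication by `A` on `ℤⁿ((B))`, extended by continuity. -/
noncomputable def seriesMul : BSeries A hA →+ BSeries A hA :=
  (laurentMul A hA).completion (laurentMul_continuous A hA)

/-- The set `ℤⁿ[[B]]` of all `y ∈ ℤⁿ((B))` with `ν(y) ≥ 0`, that is, `b ^ (-ν(y)) ≤ 1`. -/
def integralSeries : Set (BSeries A hA) := {y | ‖y‖ ≤ 1}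

theorem integralSeries_isClosed : IsClosed (integralSeries A hA) :=
  isClosed_le continuous_norm continuous_const

theorem laurent_unitBall_totallyBounded : TotallyBounded {y : Laurent A hA | ‖y‖ ≤ 1} := by
  have h := hA.isUnit_det
  rw [Metric.totallyBounded_iff]
  intro ε hε
  obtain ⟨k, hk⟩ : ∃ k : ℕ, ∀ y ∈ zLaurent A, y ∈ filt A k → bAbs A y < ε := by
    by_cases hb : 2 ≤ residueCard A⁻¹
    · obtain ⟨k, hk⟩ := exists_pow_lt_of_lt_one hε
        (inv_lt_one_of_one_lt₀ (show (1 : ℝ) < residueCard A⁻¹ by exact_mod_cast hb))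
      refine ⟨k, fun y hy hyk => ((bAbs_le_iff h hy k).2 hyk).trans_lt ?_⟩
      rwa [zpow_neg, zpow_natCast, ← inv_pow]
    · refine ⟨0, fun y _ _ => ?_⟩
      rw [bAbs_of_no_jump]
      · exact hε
      · rintro ⟨m, hm⟩
        exact hb (two_le_of_isJump h hm)
  have hfin : Finite (filt A 0 ⧸ (filt A (k : ℤ)).addSubgroupOf (filt A 0)) :=
    Nat.finite_of_card_ne_zero (relIndex_filt_ne_zero h k)
  have hle : filt A 0 ≤ zLaurent A := by
    rw [filt_zero]
    refine iSup_le fun j => ?_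
    rintro _ ⟨x, hx, rfl⟩
    refine AddSubgroup.mem_iSup_of_mem (-(j : ℤ)) ⟨x, hx, ?_⟩
    rw [← Matrix.inv_zpow' h, zpow_natCast]
  let f : filt A 0 ⧸ (filt A (k : ℤ)).addSubgroupOf (filt A 0) → Laurent A hA := fun q =>
    ⟨(Quotient.out q).1, hle (Quotient.out q).2⟩
  refine ⟨Set.range f, Set.finite_range f, ?_⟩
  intro y hy
  have hy0 : y.1 ∈ filt A 0 := by
    rw [← bAbs_le_iff h y.2, neg_zero, zpow_zero]
    exact hy
  set q : filt A 0 ⧸ (filt A (k : ℤ)).addSubgroupOf (filt A 0) :=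
    QuotientAddGroup.mk ⟨y.1, hy0⟩ with hq
  have h1 : (QuotientAddGroup.mk (Quotient.out q) :
      filt A 0 ⧸ (filt A (k : ℤ)).addSubgroupOf (filt A 0)) = QuotientAddGroup.mk ⟨y.1, hy0⟩ :=
    Quotient.out_eq q
  have h2 : -(Quotient.out q).1 + y.1 ∈ filt A (k : ℤ) := by
    have h3 := QuotientAddGroup.eq.1 h1
    exact h3
  refine Set.mem_iUnion₂.2 ⟨f q, ⟨q, rfl⟩, ?_⟩
  rw [mem_ball_iff_norm, norm_def]
  refine hk _ (y - f q).2 ?_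
  change y.1 - (Quotient.out q).1 ∈ _
  rwa [sub_eq_neg_add]

theorem integralSeries_isCompact : IsCompact (integralSeries A hA) := by
  refine TotallyBounded.isCompact_of_isClosed ?_ (integralSeries_isClosed A hA)
  refine (((laurent_unitBall_totallyBounded A hA).image
    (UniformSpace.Completion.uniformContinuous_coe _)).closure).subset ?_
  intro y hy
  rw [Metric.mem_closure_iff]
  intro ε hε
  have hd : DenseRange ((↑) : Laurent A hA → BSeries A hA) :=
    UniformSpace.Completion.denseRange_coe
  obtain ⟨x, hx⟩ := hd.exists_dist_lt y (lt_min hε zero_lt_one)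
  refine ⟨x, ⟨x, ?_, rfl⟩, hx.trans_le (min_le_left _ _)⟩
  have h1 : ‖(x : BSeries A hA)‖ < 2 := by
    have h2 : ‖(x : BSeries A hA)‖ ≤ ‖y‖ + ‖(x : BSeries A hA) - y‖ := norm_le_insert' _ _
    have h3 := hx.trans_le (min_le_right _ _)
    rw [dist_comm, dist_eq_norm] at h3
    have h4 : ‖y‖ ≤ 1 := hy
    linarith
  rw [UniformSpace.Completion.norm_coe] at h1
  exact bAbs_le_one_of_lt_two hA.isUnit_det h1

/-- `ℤⁿ[[B]]` as a compact set with nonempty interior. -/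
def integralCompacts : TopologicalSpace.PositiveCompacts (BSeries A hA) where
  carrier := integralSeries A hA
  isCompact' := integralSeries_isCompact A hA
  interior_nonempty' := by
    refine ⟨0, mem_interior_iff_mem_nhds.2 ?_⟩
    refine Filter.mem_of_superset (Metric.closedBall_mem_nhds (0 : BSeries A hA) one_pos) ?_
    intro y hy
    exact mem_closedBall_zero_iff.1 hy

/-- The `B`-adic measure: the Haar measure on `ℤⁿ((B))` for which `ℤⁿ[[B]]` has measure `1`. -/
noncomputable def seriesMeasure : Measure (BSeries A hA) :=
  Measure.addHaarMeasure (integralCompacts A hA)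

/-- The representation space `ℝⁿ × ℤⁿ((B))`. -/
abbrev RepSpace : Type := EuclideanSpace ℝ (Fin n) × BSeries A hA

/-- The product of the Lebesgue measure and the `B`-adic measure. -/
noncomputable def repMeasure : Measure (RepSpace A hA) :=
  (volume : Measure (EuclideanSpace ℝ (Fin n))).prod (seriesMeasure A hA)

/-- Multiplication by `A` on the representation space. -/
noncomputable def repMul (p : RepSpace A hA) : RepSpace A hA :=
  (Matrix.toEuclideanLin (A.map (algebraMap ℚ ℝ)) p.1, seriesMul A hA p.2)

/-- The diagonal embedding `x ↦ (x, x)` of `ℤⁿ(B)`. -/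
noncomputable def diagEmb (x : Laurent A hA) : RepSpace A hA :=
  (WithLp.toLp 2 fun i => ((x.1 i : ℚ) : ℝ), (x : BSeries A hA))

theorem zAdjoin_le_zLaurent : zAdjoin A ≤ zLaurent A :=
  iSup_le fun k => by
    have := le_iSup (fun k : ℤ => (intLattice n).map (mulHom (A ^ k))) (k : ℤ)
    rwa [zpow_natCast] at this

/-- The image of a digit under the diagonal embedding. -/
noncomputable def digitEmb (d : zAdjoin A) : RepSpace A hA :=
  diagEmb A hA ⟨d.1, zAdjoin_le_zLaurent A d.2⟩

/-- `F` is a nonempty compact subset of the representation space that satisfies the set equation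
`A F = ⋃ d ∈ D, (F + φ(d))`. -/
structure IsSelfAffineSet (D : Finset (zAdjoin A)) (F : Set (RepSpace A hA)) : Prop where
  nonempty : F.Nonempty
  isCompact : IsCompact F
  set_eq : repMul A hA '' F = ⋃ d ∈ D, (fun p => p + digitEmb A hA d) '' F

end

end RationalTile

/-! Let `T` be multiplication by `A⁻¹` on the representation space and `M` multiplication by `A`.
The operator bounds of `T^k` are summable: on the real factor because `A⁻¹` has spectral radius less
than 1, on the `B`-adic factor because `T` at least halves norms. The set equation reads `F = ⋃ T (d
+ F)`. Unrolling it forces every point of a compact solution to be a digit series `∑ T^(j+1) d_j`,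
and every such series to lie in any nonempty compact solution. Hence the range of `digitSum`, a
continuous image of the compact space of digit sequences, is the only solution (`eq_range_digitSum`,
`range_digitSum_set_eq`).

For positive measure, let `Λ` be the diagonal image of `ℤⁿ[A]`. Since `D` represents all residues,
`Λ ⊆ M Λ + φ(D)`, so `C = F + Λ` is stable under `T`. Since `Λ` is relatively dense
(`exists_digitEmb_near`), every `M^k p` is boundedly close to `C`, and applying `T^k` shows that `C`
is dense. Since `Λ` is locally finite (`finite_digitEmb_ball`), `C` is also closed, hence everything
(`iUnion_translate_eq_univ`). Countably many translates of `F` cover the space, so `F` is not null.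

The arithmetic core is local finiteness: elements of `ℤⁿ[A] ∩ A^m ℤⁿ[A⁻¹]` have a common
denominator. This follows from `ℤ[X]` being Noetherian, by a division argument on relations between
polynomial representations (`exists_polyKer_div`, `exists_bounded_polyEval`). -/

namespace RationalTile

/-! ### Self-affine sets of a homomorphism with summable iterates -/

section Contraction

variable {E : Type*} [NormedAddCommGroup E] {T : E →+ E} {c : ℕ → ℝ}

/-- The points `∑ T ^ (j + 1) d_j`, with digits `d_j` in a finite set. -/
noncomputable def digitSum (T : E →+ E) (Φ : Finset E) (δ : ℕ → Φ) : E :=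
  ∑' j, T^[j + 1] (δ j)

theorem norm_iterate_digit_le (hT : ∀ k p, ‖T^[k] p‖ ≤ c k * ‖p‖) (hc0 : ∀ k, 0 ≤ c k)
    (Φ : Finset E) (d : Φ) (j : ℕ) :
    ‖T^[j + 1] d‖ ≤ c (j + 1) * ∑ d ∈ Φ, ‖d‖ :=
  (hT _ _).trans (mul_le_mul_of_nonneg_left
    (Finset.single_le_sum (f := fun d : E => ‖d‖) (fun _ _ => norm_nonneg _) d.2) (hc0 _))

theorem summable_digit_bound (hc : Summable c) (Φ : Finset E) :
    Summable fun j => c (j + 1) * ∑ d ∈ Φ, ‖d‖ :=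
  ((summable_nat_add_iff 1).2 hc).mul_right _

theorem summable_digit [CompleteSpace E] (hT : ∀ k p, ‖T^[k] p‖ ≤ c k * ‖p‖)
    (hc0 : ∀ k, 0 ≤ c k) (hc : Summable c) (Φ : Finset E) (δ : ℕ → Φ) :
    Summable fun j => T^[j + 1] (δ j : E) :=
  Summable.of_norm_bounded (summable_digit_bound hc Φ)
    fun j => norm_iterate_digit_le hT hc0 Φ (δ j) j

/-- Each term depends on one coordinate of a finite discrete set, and the series converges
uniformly. As `ℕ → Φ` is compact, this yields compactness of the tile. -/
theorem continuous_digitSum [CompleteSpace E] (hT : ∀ k p, ‖T^[k] p‖ ≤ c k * ‖p‖)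
    (hc0 : ∀ k, 0 ≤ c k) (hc : Summable c) (Φ : Finset E) : Continuous (digitSum T Φ) := by
  refine continuous_tsum (fun j => ?_) (summable_digit_bound hc Φ)
    fun j δ => norm_iterate_digit_le hT hc0 Φ (δ j) j
  exact (continuous_of_discreteTopology (f := fun d : Φ => T^[j + 1] (d : E))).comp
    (continuous_apply j)

theorem continuous_of_iterate_bound (hT : ∀ k p, ‖T^[k] p‖ ≤ c k * ‖p‖) : Continuous T :=
  AddMonoidHomClass.continuous_of_bound T (c 1) fun p => by simpa using hT 1 p

theorem digitSum_eq [CompleteSpace E] (hT : ∀ k p, ‖T^[k] p‖ ≤ c k * ‖p‖)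
    (hc0 : ∀ k, 0 ≤ c k) (hc : Summable c) (Φ : Finset E) (δ : ℕ → Φ) :
    digitSum T Φ δ = T (δ 0 + digitSum T Φ fun j => δ (j + 1)) := by
  rw [digitSum, (summable_digit hT hc0 hc Φ δ).tsum_eq_zero_add, map_add, digitSum,
    (summable_digit hT hc0 hc Φ fun j => δ (j + 1)).map_tsum T (continuous_of_iterate_bound hT)]
  simp only [zero_add, Function.iterate_one]
  congr 1
  exact tsum_congr fun j => Function.iterate_succ_apply' _ _ _

/-- The set equation, solved for `F`. -/
theorem mem_of_set_eq {M : E → E} (hTM : Function.LeftInverse T M)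
    (hMT : Function.RightInverse T M) {Φ : Finset E} {F : Set E}
    (hF : M '' F = ⋃ d ∈ Φ, (fun p => p + d) '' F) (p : E) :
    p ∈ F ↔ ∃ d ∈ Φ, ∃ q ∈ F, p = T (d + q) := by
  have h : p ∈ F ↔ M p ∈ M '' F :=
    (Function.Injective.mem_set_image hTM.injective).symm
  rw [h, hF]
  simp only [Set.mem_iUnion, Set.mem_image, exists_prop]
  refine exists_congr fun d => and_congr_right fun _ => exists_congr fun q =>
    and_congr_right fun _ => ?_
  constructor
  · intro h
    rw [add_comm d q, h, hTM]
  · rintro rfl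
    rw [hMT, add_comm]

theorem exists_digits {M : E → E} (hTM : Function.LeftInverse T M)
    (hMT : Function.RightInverse T M) {Φ : Finset E} {F : Set E}
    (hF : M '' F = ⋃ d ∈ Φ, (fun p => p + d) '' F) {p : E} (hp : p ∈ F) :
    ∃ δ : ℕ → Φ, ∃ q : ℕ → F, q 0 = p ∧ ∀ j, (q j : E) = T (δ j + q (j + 1)) := by
  -- `d p` is a first digit of `p` and `g p` the remaining point of `F`; iterating `g` produces the
  -- whole expansion.
  choose! d hd g hg h using fun p => (mem_of_set_eq hTM hMT hF p).1
  let q : ℕ → F := fun k => (fun x : F => (⟨g x, hg x x.2⟩ : F))^[k] ⟨p, hp⟩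
  refine ⟨fun j => ⟨d (q j), hd _ (q j).2⟩, q, rfl, fun j => ?_⟩
  simp only [q, Function.iterate_succ_apply']
  exact h _ (q j).2

theorem eq_partial_sum (T : E →+ E) {δ q : ℕ → E} (h : ∀ j, q j = T (δ j + q (j + 1))) (k : ℕ) :
    q 0 = ∑ j ∈ Finset.range k, T^[j + 1] (δ j) + T^[k] (q k) := by
  induction k with
  | zero => simp
  | succ k ih =>
    rw [ih, Finset.sum_range_succ, add_assoc]
    congr 1
    rw [h k, ← Function.iterate_succ_apply, iterate_map_add]

theorem tendsto_iterate_zero (hT : ∀ k p, ‖T^[k] p‖ ≤ c k * ‖p‖) (hc0 : ∀ k, 0 ≤ c k)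
    (hc : Summable c) {q : ℕ → E} {R : ℝ} (hq : ∀ k, ‖q k‖ ≤ R) :
    Filter.Tendsto (fun k => T^[k] (q k)) Filter.atTop (nhds 0) := by
  refine squeeze_zero_norm (fun k => (hT k (q k)).trans
    (mul_le_mul_of_nonneg_left (hq k) (hc0 k))) ?_
  simpa using hc.tendsto_atTop_zero.mul_const R

/-- Unrolling `k` times leaves the remainder `T^k (q k)`, which vanishes in the limit because the `q
k` stay bounded. -/
theorem digitSum_eq_of_bounded [CompleteSpace E] (hT : ∀ k p, ‖T^[k] p‖ ≤ c k * ‖p‖)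
    (hc0 : ∀ k, 0 ≤ c k) (hc : Summable c) {Φ : Finset E} {δ : ℕ → Φ} {q : ℕ → E}
    (h : ∀ j, q j = T (δ j + q (j + 1))) {R : ℝ} (hq : ∀ k, ‖q k‖ ≤ R) :
    q 0 = digitSum T Φ δ := by
  have h1 := (summable_digit hT hc0 hc Φ δ).hasSum.tendsto_sum_nat.add
    (tendsto_iterate_zero hT hc0 hc hq)
  rw [add_zero] at h1
  refine tendsto_nhds_unique ?_ h1
  simp_rw [← eq_partial_sum T h]
  exact tendsto_const_nhds

/-- This is uniqueness. Compactness enters twice: boundedness makes each expansion converge to its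
point, and closedness captures the limit of partial sums. -/
theorem eq_range_digitSum [CompleteSpace E] (hT : ∀ k p, ‖T^[k] p‖ ≤ c k * ‖p‖)
    (hc0 : ∀ k, 0 ≤ c k) (hc : Summable c) {M : E → E} (hTM : Function.LeftInverse T M)
    (hMT : Function.RightInverse T M) {Φ : Finset E} {F : Set E} (hne : F.Nonempty)
    (hcpt : IsCompact F) (hF : M '' F = ⋃ d ∈ Φ, (fun p => p + d) '' F) :
    F = Set.range (digitSum T Φ) := by
  obtain ⟨R, hR⟩ := hcpt.isBounded.exists_norm_le
  apply Set.Subset.antisymm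
  · intro p hp
    obtain ⟨δ, q, hq0, hq⟩ := exists_digits hTM hMT hF hp
    refine ⟨δ, ?_⟩
    rw [← hq0]
    exact (digitSum_eq_of_bounded hT hc0 hc (q := fun k => q k) hq fun k => hR _ (q k).2).symm
  · rintro _ ⟨δ, rfl⟩
    obtain ⟨f, hf⟩ := hne
    -- A partial sum alone need not lie in `F`; ended by the tail `T^k f` with `f ∈ F` it does. The
    -- induction removes the first digit, so `δ` must stay general.
    have hmem : ∀ k, ∀ δ : ℕ → Φ,
        ∑ j ∈ Finset.range k, T^[j + 1] (δ j : E) + T^[k] f ∈ F := by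
      intro k
      induction k with
      | zero => intro δ; simpa using hf
      | succ k ih =>
        intro δ
        refine (mem_of_set_eq hTM hMT hF _).2 ⟨δ 0, (δ 0).2, _, ih fun j => δ (j + 1), ?_⟩
        rw [Finset.sum_range_succ', map_add, map_add, map_sum, Function.iterate_succ_apply']
        simp only [← Function.iterate_succ_apply']
        simp only [Function.iterate_one]
        abel
    have h1 := (summable_digit hT hc0 hc Φ δ).hasSum.tendsto_sum_nat.add
      (tendsto_iterate_zero hT hc0 hc (q := fun _ => f) fun _ => le_rfl)
    rw [add_zero] at h1
    exact hcpt.isClosed.mem_of_tendsto h1 (Filter.Eventually.of_forall fun k => hmem k δ)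

theorem range_digitSum_set_eq [CompleteSpace E] (hT : ∀ k p, ‖T^[k] p‖ ≤ c k * ‖p‖)
    (hc0 : ∀ k, 0 ≤ c k) (hc : Summable c) {M : E → E} (hMT : Function.RightInverse T M)
    (Φ : Finset E) :
    M '' Set.range (digitSum T Φ) = ⋃ d ∈ Φ, (fun p => p + d) '' Set.range (digitSum T Φ) := by
  ext x
  simp only [Set.mem_iUnion, Set.mem_image, Set.mem_range, exists_prop, exists_exists_eq_and]
  constructor
  · rintro ⟨δ, rfl⟩
    refine ⟨δ 0, (δ 0).2, fun j => δ (j + 1), ?_⟩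
    rw [digitSum_eq hT hc0 hc Φ δ, hMT, add_comm]
  · rintro ⟨d, hd, δ, rfl⟩
    refine ⟨fun j => Nat.casesOn j ⟨d, hd⟩ δ, ?_⟩
    rw [digitSum_eq hT hc0 hc, hMT, add_comm]
    rfl

/-- A set invariant under translation by a relatively dense, locally finite digit module covers
the whole space. -/
theorem iUnion_translate_eq_univ (hT : ∀ k p, ‖T^[k] p‖ ≤ c k * ‖p‖) (hc0 : ∀ k, 0 ≤ c k)
    (hc : Summable c) {M : E →+ E} (hTM : Function.LeftInverse T M)
    (hMT : Function.RightInverse T M) {Φ : Finset E} {F : Set E} (hne : F.Nonempty)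
    (hcpt : IsCompact F) (hF : M '' F = ⋃ d ∈ Φ, (fun p => p + d) '' F) {Λ : Set E}
    (hΛ : ∀ x ∈ Λ, ∃ d ∈ Φ, ∃ y ∈ Λ, x = M y + d)
    (hfin : ∀ R, {x ∈ Λ | ‖x‖ ≤ R}.Finite) {R : ℝ} (hdense : ∀ p, ∃ x ∈ Λ, ‖p - x‖ ≤ R) :
    ⋃ x ∈ Λ, (fun p => p + x) '' F = Set.univ := by
  set C := ⋃ x ∈ Λ, (fun p => p + x) '' F with hC
  -- With `x = M y + d`, the point `T (f + x)` equals `T (d + f) + y`, and `T (d + f)` is again in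
  -- `F`.
  have hTC : ∀ p ∈ C, T p ∈ C := by
    intro p hp
    simp only [hC, Set.mem_iUnion, Set.mem_image, exists_prop] at hp ⊢
    obtain ⟨x, hx, f, hf, rfl⟩ := hp
    obtain ⟨d, hd, y, hy, rfl⟩ := hΛ x hx
    refine ⟨y, hy, T (d + f), (mem_of_set_eq hTM hMT hF _).2 ⟨d, hd, f, hf, rfl⟩, ?_⟩
    simp only [map_add, hTM y]
    abel
  have hTC' : ∀ k, ∀ p ∈ C, T^[k] p ∈ C := by
    intro k
    induction k with
    | zero => exact fun p hp => hp
    | succ k ih => exact fun p hp => ih _ (hTC p hp)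
  obtain ⟨f, hf⟩ := hne
  have hcl : closure C = Set.univ := by
    refine Set.eq_univ_of_forall fun p => ?_
    choose x hx hxR using fun k => hdense (M^[k] p)
    have hTMk : ∀ k, T^[k] (M^[k] p) = p := fun k => hTM.iterate k p
    -- The point `f + x k` of `C` is within `R + ‖f‖` of `M^k p`; after applying `T^k` the error
    -- tends to 0, while the approximating point stays in `C`.
    have h1 := tendsto_iterate_zero hT hc0 hc (q := fun k => M^[k] p - (f + x k)) (R := R + ‖f‖)
      fun k => by
        rw [show M^[k] p - (f + x k) = (M^[k] p - x k) - f by abel]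
        exact (norm_sub_le _ _).trans (add_le_add_left (hxR k) _)
    have h2 := (tendsto_const_nhds (x := p)).sub h1
    rw [sub_zero] at h2
    refine mem_closure_of_tendsto h2 (Filter.Eventually.of_forall fun k => ?_)
    rw [iterate_map_sub, hTMk, sub_sub_cancel]
    refine hTC' k _ ?_
    simp only [hC, Set.mem_iUnion, Set.mem_image, exists_prop]
    exact ⟨x k, hx k, f, hf, rfl⟩
  obtain ⟨S, hS⟩ := hcpt.isBounded.exists_norm_le
  refine Set.eq_univ_of_forall fun p => ?_
  -- Only these finitely many translates can meet the unit ball around `p`, since `S` bounds the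
  -- norms in `F`. Their union is closed, so density puts `p` in it.
  set Λ₀ := {x ∈ Λ | ‖x‖ ≤ ‖p‖ + 1 + S}
  have hcl0 : IsClosed (⋃ x ∈ Λ₀, (fun p => p + x) '' F) :=
    (hfin _).isClosed_biUnion fun x _ => (hcpt.image (by fun_prop)).isClosed
  have hp : p ∈ closure (C ∩ Metric.ball p 1) := by
    rw [mem_closure_iff_nhds]
    intro t ht
    have h3 : p ∈ closure C := hcl ▸ Set.mem_univ p
    obtain ⟨y, hy, hyC⟩ := mem_closure_iff_nhds.1 h3 _
      (Filter.inter_mem ht (Metric.ball_mem_nhds p one_pos))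
    exact ⟨y, hy.1, hyC, hy.2⟩
  have hsub : C ∩ Metric.ball p 1 ⊆ ⋃ x ∈ Λ₀, (fun p => p + x) '' F := by
    rintro y ⟨hy, hyp⟩
    simp only [hC, Set.mem_iUnion, Set.mem_image, exists_prop] at hy ⊢
    obtain ⟨x, hx, g, hg, rfl⟩ := hy
    refine ⟨x, ⟨hx, ?_⟩, g, hg, rfl⟩
    have h4 := hS g hg
    rw [mem_ball_iff_norm] at hyp
    calc ‖x‖ = ‖p + (g + x - p) - g‖ := by congr 1; abel
      _ ≤ ‖p + (g + x - p)‖ + ‖g‖ := norm_sub_le _ _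
      _ ≤ ‖p‖ + ‖g + x - p‖ + ‖g‖ := by gcongr; exact norm_add_le _ _
      _ ≤ ‖p‖ + 1 + S := by gcongr
  have := closure_minimal hsub hcl0 hp
  simp only [hC, Set.mem_iUnion, exists_prop] at this ⊢
  obtain ⟨x, hx, h5⟩ := this
  exact ⟨x, hx.1, h5⟩

end Contraction

/-! ### Decay of the powers of `A⁻¹` -/

section Spectrum

attribute [local instance] Matrix.linftyOpNormedRing Matrix.linftyOpNormedAlgebra

/-- The powers of a matrix whose eigenvalues lie in the open unit disk are summable. -/
theorem exists_summable_pow_bound {n : ℕ} (B : Matrix (Fin n) (Fin n) ℂ)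
    (hB : ∀ z ∈ spectrum ℂ B, ‖z‖ < 1) :
    ∃ c : ℕ → ℝ, (∀ k, 0 ≤ c k) ∧ Summable c ∧ ∀ k i, ∑ j, ‖(B ^ k) i j‖ ≤ c k := by
  refine ⟨fun k => ‖B ^ k‖, fun _ => norm_nonneg _, ?_, fun k i => ?_⟩
  -- The matrix ring is trivial when `n = 0`; all norms are then 0.
  · rcases subsingleton_or_nontrivial (Matrix (Fin n) (Fin n) ℂ) with h | h
    · have : ∀ k, B ^ k = 0 := fun k => Subsingleton.elim _ _
      simp only [this, norm_zero]
      exact summable_zero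
    have h1 : spectralRadius ℂ B < (1 : NNReal) :=
      spectrum.spectralRadius_lt_of_forall_lt B fun z hz => by
        rw [← NNReal.coe_lt_coe]
        exact hB z hz
    obtain ⟨r, hr1, hr2⟩ := ENNReal.lt_iff_exists_nnreal_btwn.1 h1
    -- Gelfand's formula: eventually `‖B ^ k‖ < r ^ k` with `r < 1`, so a geometric series
    -- dominates.
    have h2 := (spectrum.pow_nnnorm_pow_one_div_tendsto_nhds_spectralRadius B).eventually_lt_const
      hr1
    have hr : (r : ℝ) < 1 := by exact_mod_cast hr2
    refine (summable_geometric_of_lt_one r.2 hr).of_norm_bounded_eventually_nat ?_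
    filter_upwards [h2, Filter.eventually_gt_atTop 0] with k hk hk0
    rw [norm_norm]
    have hk0' : (0 : ℝ) < k := by exact_mod_cast hk0
    rw [one_div, ENNReal.rpow_inv_lt_iff hk0', ENNReal.rpow_natCast] at hk
    have : ‖B ^ k‖₊ < r ^ k := by exact_mod_cast hk
    exact_mod_cast this.le
  -- The chosen operator norm is the largest absolute row sum.
  · have := Finset.le_sup (f := fun i => ∑ j, ‖(B ^ k) i j‖₊) (Finset.mem_univ i)
    rw [← Matrix.linfty_opNNNorm_def] at this
    simpa only [NNReal.coe_sum, coe_nnnorm] using NNReal.coe_le_coe.2 this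

end Spectrum

/-- The entries of the powers of `A⁻¹` are summable if `A` is expanding. -/
theorem IsExpanding.exists_summable {n : ℕ} {A : Matrix (Fin n) (Fin n) ℚ} (hA : IsExpanding A) :
    ∃ c : ℕ → ℝ, (∀ k, 0 ≤ c k) ∧ Summable c ∧ ∀ k i, ∑ j, |((A⁻¹ ^ k) i j : ℝ)| ≤ c k := by
  set ι := algebraMap ℚ ℂ
  have hu : A.map ι * A⁻¹.map ι = 1 := by
    rw [← Matrix.map_mul, Matrix.mul_nonsing_inv _ hA.isUnit_det,
      Matrix.map_one _ (map_zero _) (map_one _)]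
  have hu' : A⁻¹.map ι * A.map ι = 1 := by
    rw [← Matrix.map_mul, Matrix.nonsing_inv_mul _ hA.isUnit_det,
      Matrix.map_one _ (map_zero _) (map_one _)]
  let u : (Matrix (Fin n) (Fin n) ℂ)ˣ := ⟨A.map ι, A⁻¹.map ι, hu, hu'⟩
  obtain ⟨c, hc0, hc, h⟩ := exists_summable_pow_bound (A⁻¹.map ι) fun z hz => by
    have hz0 : z ≠ 0 := spectrum.ne_zero_of_mem_of_unit (a := u⁻¹) hz
    have h1 : z⁻¹ ∈ spectrum ℂ (A.map ι) := by
      have := (spectrum.inv_mem_iff (r := Units.mk0 z hz0) (a := u⁻¹)).1 hz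
      rwa [inv_inv u, Units.val_inv_eq_inv_val] at this
    have := hA _ h1
    rw [norm_inv] at this
    exact (one_lt_inv₀ (norm_pos_iff.2 hz0)).1 this
  refine ⟨c, hc0, hc, fun k i => ?_⟩
  convert h k i using 2 with j
  rw [← Matrix.map_pow, Matrix.map_apply]
  simp [ι]

/-! ### Multiplication by `A⁻¹` on the representation space -/

section
variable {n : ℕ} (A : Matrix (Fin n) (Fin n) ℚ) (hA : IsExpanding A)

theorem mulHom_inv_mem_zLaurent (h : IsUnit A.det) {y : Fin n → ℚ} (hy : y ∈ zLaurent A) :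
    mulHom A⁻¹ y ∈ zLaurent A := by
  have : (zLaurent A).map (mulHom A⁻¹) ≤ zLaurent A := by
    rw [zLaurent, AddSubgroup.map_iSup]
    refine iSup_le fun k => ?_
    rintro _ ⟨_, ⟨x, hx, rfl⟩, rfl⟩
    refine AddSubgroup.mem_iSup_of_mem (-1 + k) ⟨x, hx, ?_⟩
    rw [mulHom_comp, Matrix.zpow_add h, Matrix.zpow_neg_one]
  exact this ⟨y, hy, rfl⟩

theorem mulHom_mul_inv (h : IsUnit A.det) (y : Fin n → ℚ) : mulHom A (mulHom A⁻¹ y) = y := by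
  rw [mulHom_comp, Matrix.mul_nonsing_inv _ h, mulHom_one]

theorem mulHom_inv_mul (h : IsUnit A.det) (y : Fin n → ℚ) : mulHom A⁻¹ (mulHom A y) = y := by
  rw [mulHom_comp, Matrix.nonsing_inv_mul _ h, mulHom_one]

/-- The true factor is `1 / b`, and `b ≥ 2` as soon as any jump exists. The constant `1 / 2` also
covers `b = 1`, where `bAbs` vanishes identically. -/
theorem bAbs_mul_inv_le (h : IsUnit A.det) (y : Fin n → ℚ) :
    bAbs A (mulHom A⁻¹ y) ≤ 2⁻¹ * bAbs A y := by
  by_cases hj : ∃ m, IsJump A (mulHom A⁻¹ y) m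
  · obtain ⟨m, hm⟩ := hj
    have hb : (2 : ℝ) ≤ residueCard A⁻¹ := by exact_mod_cast two_le_of_isJump h hm
    have h1 := bAbs_mul h (mulHom A⁻¹ y)
    rw [mulHom_mul_inv A h] at h1
    have h2 := mul_le_mul_of_nonneg_right hb (bAbs_nonneg (A := A) (mulHom A⁻¹ y))
    linarith
  · rw [bAbs_of_no_jump hj]
    exact mul_nonneg (by norm_num) (bAbs_nonneg y)

/-- Multiplication by `A⁻¹` on `ℤⁿ(B)`. -/
noncomputable def laurentInvMul : Laurent A hA →+ Laurent A hA where
  toFun y := ⟨mulHom A⁻¹ y.1, mulHom_inv_mem_zLaurent A hA.isUnit_det y.2⟩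
  map_zero' := Subtype.ext (map_zero (mulHom A⁻¹))
  map_add' x y := Subtype.ext (map_add (mulHom A⁻¹) x.1 y.1)

theorem norm_laurentInvMul_le (y : Laurent A hA) : ‖laurentInvMul A hA y‖ ≤ 2⁻¹ * ‖y‖ :=
  bAbs_mul_inv_le A hA.isUnit_det y.1

theorem laurentInvMul_continuous : Continuous (laurentInvMul A hA) :=
  AddMonoidHomClass.continuous_of_bound (laurentInvMul A hA) 2⁻¹ (norm_laurentInvMul_le A hA)

/-- Multiplication by `A⁻¹` on `ℤⁿ((B))`. -/
noncomputable def seriesInvMul : BSeries A hA →+ BSeries A hA :=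
  (laurentInvMul A hA).completion (laurentInvMul_continuous A hA)

theorem seriesMul_coe (y : Laurent A hA) :
    seriesMul A hA (y : BSeries A hA) = (laurentMul A hA y : BSeries A hA) :=
  AddMonoidHom.completion_coe _ (laurentMul_continuous A hA) y

theorem seriesInvMul_coe (y : Laurent A hA) :
    seriesInvMul A hA (y : BSeries A hA) = (laurentInvMul A hA y : BSeries A hA) :=
  AddMonoidHom.completion_coe _ (laurentInvMul_continuous A hA) y

theorem seriesMul_continuous : Continuous (seriesMul A hA) :=
  AddMonoidHom.continuous_completion _ (laurentMul_continuous A hA)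

theorem seriesInvMul_continuous : Continuous (seriesInvMul A hA) :=
  AddMonoidHom.continuous_completion _ (laurentInvMul_continuous A hA)

theorem norm_seriesInvMul_le (y : BSeries A hA) : ‖seriesInvMul A hA y‖ ≤ 2⁻¹ * ‖y‖ := by
  induction y using UniformSpace.Completion.induction_on with
  | hp =>
    exact isClosed_le (seriesInvMul_continuous A hA).norm (continuous_const.mul continuous_norm)
  | ih y =>
    rw [seriesInvMul_coe, UniformSpace.Completion.norm_coe, UniformSpace.Completion.norm_coe]
    exact norm_laurentInvMul_le A hA y

theorem seriesMul_inv (y : BSeries A hA) : seriesMul A hA (seriesInvMul A hA y) = y := by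
  induction y using UniformSpace.Completion.induction_on with
  | hp =>
    exact isClosed_eq ((seriesMul_continuous A hA).comp (seriesInvMul_continuous A hA))
      continuous_id
  | ih y =>
    rw [seriesInvMul_coe, seriesMul_coe]
    congr 1
    exact Subtype.ext (mulHom_mul_inv A hA.isUnit_det y.1)

theorem seriesInvMul_mul (y : BSeries A hA) : seriesInvMul A hA (seriesMul A hA y) = y := by
  induction y using UniformSpace.Completion.induction_on with
  | hp =>
    exact isClosed_eq ((seriesInvMul_continuous A hA).comp (seriesMul_continuous A hA))
      continuous_id
  | ih y =>
    rw [seriesMul_coe, seriesInvMul_coe]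
    congr 1
    exact Subtype.ext (mulHom_inv_mul A hA.isUnit_det y.1)

theorem norm_seriesInvMul_iterate_le (k : ℕ) (y : BSeries A hA) :
    ‖(seriesInvMul A hA)^[k] y‖ ≤ (1 / 2) ^ k * ‖y‖ := by
  induction k with
  | zero => simp
  | succ k ih =>
    rw [Function.iterate_succ_apply', pow_succ']
    refine (norm_seriesInvMul_le A hA _).trans ?_
    linarith

/-- Multiplication by a rational matrix on `ℝⁿ`. -/
noncomputable def realMul (M : Matrix (Fin n) (Fin n) ℚ) :
    EuclideanSpace ℝ (Fin n) →ₗ[ℝ] EuclideanSpace ℝ (Fin n) :=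
  Matrix.toEuclideanLin (M.map (algebraMap ℚ ℝ))

theorem realMul_apply (M : Matrix (Fin n) (Fin n) ℚ) (x : EuclideanSpace ℝ (Fin n)) (i : Fin n) :
    realMul M x i = ∑ j, (M i j : ℝ) * x j := by
  simp [realMul, Matrix.toLpLin_apply, Matrix.mulVec, dotProduct]

theorem realMul_realMul (M N : Matrix (Fin n) (Fin n) ℚ) (x : EuclideanSpace ℝ (Fin n)) :
    realMul M (realMul N x) = realMul (M * N) x := by
  rw [realMul, realMul, realMul, Matrix.map_mul]
  simp [Matrix.toLpLin_apply]

theorem realMul_one (x : EuclideanSpace ℝ (Fin n)) : realMul 1 x = x := by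
  ext i
  simp [realMul_apply, Matrix.one_apply, apply_ite (Rat.cast : ℚ → ℝ)]

theorem realMul_iterate (M : Matrix (Fin n) (Fin n) ℚ) (k : ℕ) (x : EuclideanSpace ℝ (Fin n)) :
    (realMul M)^[k] x = realMul (M ^ k) x := by
  induction k with
  | zero => rw [pow_zero, realMul_one, Function.iterate_zero, id]
  | succ k ih => rw [Function.iterate_succ_apply', ih, realMul_realMul, pow_succ']

theorem norm_realMul_le (M : Matrix (Fin n) (Fin n) ℚ) {c : ℝ}
    (hM : ∀ i, ∑ j, |(M i j : ℝ)| ≤ c) (x : EuclideanSpace ℝ (Fin n)) :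
    ‖realMul M x‖ ≤ n * c * ‖x‖ := by
  have h1 : ∀ i, ‖realMul M x i‖ ≤ c * ‖x‖ := by
    intro i
    rw [realMul_apply]
    refine (norm_sum_le _ _).trans ?_
    refine le_trans ?_ (mul_le_mul_of_nonneg_right (hM i) (norm_nonneg x))
    rw [Finset.sum_mul]
    refine Finset.sum_le_sum fun j _ => ?_
    rw [norm_mul, Real.norm_eq_abs]
    gcongr
    exact PiLp.norm_apply_le x j
  -- Passing from the Euclidean norm to the sum of coordinates costs the factor `n`, harmless for
  -- summability.
  have h2 : ‖realMul M x‖ ≤ ∑ i, ‖realMul M x i‖ := by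
    rw [EuclideanSpace.norm_eq]
    refine Real.sqrt_le_iff.2 ⟨Finset.sum_nonneg fun _ _ => norm_nonneg _, ?_⟩
    exact Finset.sum_sq_le_sq_sum_of_nonneg fun _ _ => norm_nonneg _
  refine h2.trans ((Finset.sum_le_sum fun i _ => h1 i).trans ?_)
  simp [mul_assoc]

/-- `repMul` as a group homomorphism. -/
noncomputable def repMulHom : RepSpace A hA →+ RepSpace A hA :=
  (realMul A).toAddMonoidHom.prodMap (seriesMul A hA)

/-- Multiplication by `A⁻¹` on the representation space. -/
noncomputable def repInvMul : RepSpace A hA →+ RepSpace A hA :=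
  (realMul A⁻¹).toAddMonoidHom.prodMap (seriesInvMul A hA)

theorem repInvMul_leftInverse : Function.LeftInverse (repInvMul A hA) (repMulHom A hA) := fun p =>
  Prod.ext
    (show realMul A⁻¹ (realMul A p.1) = p.1 by
      rw [realMul_realMul, Matrix.nonsing_inv_mul _ hA.isUnit_det, realMul_one])
    (seriesInvMul_mul A hA p.2)

theorem repInvMul_rightInverse : Function.RightInverse (repInvMul A hA) (repMulHom A hA) :=
  fun p => Prod.ext
    (show realMul A (realMul A⁻¹ p.1) = p.1 by
      rw [realMul_realMul, Matrix.mul_nonsing_inv _ hA.isUnit_det, realMul_one])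
    (seriesMul_inv A hA p.2)

theorem repInvMul_iterate (k : ℕ) (p : RepSpace A hA) :
    (repInvMul A hA)^[k] p = ((realMul A⁻¹)^[k] p.1, (seriesInvMul A hA)^[k] p.2) := by
  induction k with
  | zero => rfl
  | succ k ih => rw [Function.iterate_succ_apply', ih, Function.iterate_succ_apply',
      Function.iterate_succ_apply']; rfl

/-- The product carries the maximum norm; adding the bounds of the two factors dominates both and
keeps the sequence summable. -/
theorem norm_repInvMul_iterate_le {c : ℕ → ℝ} (hc0 : ∀ k, 0 ≤ c k)
    (hc : ∀ k i, ∑ j, |((A⁻¹ ^ k) i j : ℝ)| ≤ c k) (k : ℕ) (p : RepSpace A hA) :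
    ‖(repInvMul A hA)^[k] p‖ ≤ (n * c k + (1 / 2) ^ k) * ‖p‖ := by
  have hn : 0 ≤ n * c k := mul_nonneg (Nat.cast_nonneg _) (hc0 k)
  have hp : (0 : ℝ) ≤ (1 / 2) ^ k := by positivity
  rw [repInvMul_iterate, Prod.norm_def, realMul_iterate]
  refine max_le ((norm_realMul_le _ (hc k) _).trans ?_)
    ((norm_seriesInvMul_iterate_le A hA k p.2).trans ?_)
  · exact mul_le_mul (by linarith) (norm_fst_le p) (norm_nonneg _) (by linarith)
  · exact mul_le_mul (by linarith) (norm_snd_le p) (norm_nonneg _) (by linarith)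

end

/-! ### Bounded denominators, by way of `ℤ[X]`-modules -/

section
open Polynomial
variable {n : ℕ} (A : Matrix (Fin n) (Fin n) ℚ)

/-- The map `ℤ[X]ⁿ → ℚⁿ` that sends `X ^ k v` to `A ^ k v`. -/
noncomputable def polyEval : (Fin n → ℤ[X]) →+ (Fin n → ℚ) where
  toFun f := ∑ i, mulHom (aeval A (f i)) (Pi.single i 1)
  map_zero' := by simp [mulHom]
  map_add' f g := by simp [mulHom, Finset.sum_add_distrib]

theorem polyEval_apply (f : Fin n → ℤ[X]) :
    polyEval A f = ∑ i, mulHom (aeval A (f i)) (Pi.single i 1) := rfl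

theorem polyEval_smul (p : ℤ[X]) (f : Fin n → ℤ[X]) :
    polyEval A (p • f) = mulHom (aeval A p) (polyEval A f) := by
  simp only [polyEval_apply, map_sum, mulHom_comp, Pi.smul_apply, smul_eq_mul, map_mul]

theorem polyEval_X_pow_smul (k : ℕ) (f : Fin n → ℤ[X]) :
    polyEval A ((X ^ k : ℤ[X]) • f) = mulHom (A ^ k) (polyEval A f) := by
  rw [polyEval_smul, aeval_X_pow]

theorem polyEval_C (v : Fin n → ℤ) :
    polyEval A (fun i => C (v i)) = (Int.castAddHom ℚ).compLeft (Fin n) v := by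
  ext j
  simp [polyEval_apply, mulHom, Matrix.intCast_apply, Finset.sum_apply]

theorem exists_polyEval_eq {z : Fin n → ℚ} (hz : z ∈ zAdjoin A) : ∃ f, polyEval A f = z := by
  have : zAdjoin A ≤ (polyEval A).range := by
    refine iSup_le fun k => ?_
    rintro _ ⟨_, ⟨v, rfl⟩, rfl⟩
    exact ⟨(X ^ k : ℤ[X]) • fun i => C (v i), by rw [polyEval_X_pow_smul, polyEval_C]⟩
  exact this hz

/-- A high enough power of `A` clears the negative powers. The bound of the degree by the same `J`
records that `w` involves no positive power of `A`. -/
theorem exists_polyEval_eq_of_inv (h : IsUnit A.det) {w : Fin n → ℚ} (hw : w ∈ zAdjoin A⁻¹) :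
    ∃ (J : ℕ) (g : Fin n → ℤ[X]), (∀ i, (g i).natDegree ≤ J) ∧
      mulHom (A ^ J) w = polyEval A g := by
  rw [zAdjoin] at hw
  refine AddSubgroup.iSup_induction _ (C := fun w => ∃ (J : ℕ) (g : Fin n → ℤ[X]),
    (∀ i, (g i).natDegree ≤ J) ∧ mulHom (A ^ J) w = polyEval A g) hw ?_ ?_ ?_
  · rintro k _ ⟨_, ⟨v, rfl⟩, rfl⟩
    refine ⟨k, fun i => C (v i), fun i => by simp, ?_⟩
    rw [polyEval_C, mulHom_comp, Matrix.inv_pow', Matrix.mul_nonsing_inv _ (by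
      rw [Matrix.det_pow]; exact h.pow k), mulHom_one]
  · exact ⟨0, 0, by simp, by simp⟩
  · rintro x y ⟨J, g, hg, hx⟩ ⟨K, f, hf, hy⟩
    -- `J + K` serves as a common exponent for both summands.
    refine ⟨J + K, (X ^ K : ℤ[X]) • g + (X ^ J : ℤ[X]) • f, fun i => ?_, ?_⟩
    · refine natDegree_add_le_of_degree_le ?_ ?_
      · rw [add_comm]
        exact natDegree_mul_le_of_le (natDegree_X_pow_le K) (hg i)
      · exact natDegree_mul_le_of_le (natDegree_X_pow_le J) (hf i)
    · rw [map_add, map_add, polyEval_X_pow_smul, polyEval_X_pow_smul, ← hx, ← hy, mulHom_comp,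
        mulHom_comp, ← pow_add, ← pow_add, add_comm K J]

/-- The kernel of `polyEval`. -/
noncomputable def polyKer : Submodule ℤ[X] (Fin n → ℤ[X]) where
  __ := (polyEval A).ker.toAddSubmonoid
  smul_mem' p f hf := by
    have : polyEval A f = 0 := hf
    change polyEval A (p • f) = 0
    rw [polyEval_smul, this, map_zero]

theorem mem_polyKer {f : Fin n → ℤ[X]} : f ∈ polyKer A ↔ polyEval A f = 0 := Iff.rfl

/-- Division of the elements of the kernel by powers of `X`, with remainders of bounded degree. -/
theorem exists_polyKer_div : ∃ m : ℕ, ∀ J : ℕ, ∀ u ∈ polyKer A, ∃ u₁ ∈ polyKer A,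
    ∀ i, ((u - (X ^ J : ℤ[X]) • u₁) i).natDegree ≤ J + m := by
  obtain ⟨S, hS⟩ := IsNoetherian.noetherian (polyKer A)
  -- The kernel is finitely generated, and `m` is the largest degree in a generator. Dividing the
  -- coefficients of `u` by `X ^ J`, rather than `u` itself, keeps the quotient in the kernel.
  refine ⟨S.sup fun h => Finset.univ.sup fun i => (h i).natDegree, fun J u hu => ?_⟩
  rw [← hS] at hu ⊢
  induction hu using Submodule.closure_induction with
  | zero => exact ⟨0, zero_mem _, by simp⟩
  | add x y _ _ hx hy =>
    obtain ⟨x₁, hx₁, hx⟩ := hx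
    obtain ⟨y₁, hy₁, hy⟩ := hy
    refine ⟨x₁ + y₁, add_mem hx₁ hy₁, fun i => ?_⟩
    rw [smul_add, add_sub_add_comm]
    exact natDegree_add_le_of_degree_le (hx i) (hy i)
  | smul_mem p h hh =>
    refine ⟨(p /ₘ X ^ J) • h, Submodule.smul_mem _ _ (Submodule.subset_span hh), fun i => ?_⟩
    have h1 : p • h - (X ^ J : ℤ[X]) • (p /ₘ X ^ J) • h = (p %ₘ X ^ J) • h := by
      rw [smul_smul, ← sub_smul]
      congr 1
      rw [sub_eq_iff_eq_add, modByMonic_add_div]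
    rw [h1]
    refine natDegree_mul_le_of_le ?_ ?_
    · have := natDegree_modByMonic_le p (monic_X_pow (R := ℤ) J)
      rwa [natDegree_X_pow] at this
    · exact (Finset.le_sup (f := fun i => (h i).natDegree) (Finset.mem_univ i)).trans
        (Finset.le_sup (f := fun h : Fin n → ℤ[X] => Finset.univ.sup fun i => (h i).natDegree) hh)

/-- Write `z = f(A)` and `z = A^m w` with `A^J w = g(A)`. Then `X^J f - X^m g` is a relation;
subtracting its quotient by `X^J` from `f` leaves `z` unchanged and brings the degree down to a
bound independent of `z` and `J`. -/
theorem exists_bounded_polyEval (h : IsUnit A.det) (m : ℕ) : ∃ K : ℕ, ∀ z ∈ zAdjoin A,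
    z ∈ filt A (-m) → ∃ f : Fin n → ℤ[X], (∀ i, (f i).natDegree ≤ K) ∧ polyEval A f = z := by
  obtain ⟨m₀, hm₀⟩ := exists_polyKer_div A
  refine ⟨m + m₀, fun z hz hz' => ?_⟩
  obtain ⟨f, rfl⟩ := exists_polyEval_eq A hz
  obtain ⟨w, hw, hwz⟩ := hz'
  obtain ⟨J, g, hg, hJ⟩ := exists_polyEval_eq_of_inv A h hw
  rw [Matrix.inv_zpow' h, neg_neg, zpow_natCast] at hwz
  have hker : (X ^ J : ℤ[X]) • f - (X ^ m : ℤ[X]) • g ∈ polyKer A := by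
    rw [mem_polyKer, map_sub, polyEval_X_pow_smul, polyEval_X_pow_smul, ← hJ, ← hwz, mulHom_comp,
      mulHom_comp, ← pow_add, ← pow_add, add_comm, sub_self]
  obtain ⟨u₁, hu₁, hu⟩ := hm₀ J _ hker
  refine ⟨f - u₁, fun i => ?_, by rw [map_sub, (mem_polyKer A).1 hu₁, sub_zero]⟩
  have h1 : ((X ^ J : ℤ[X]) * (f - u₁) i).natDegree ≤ J + (m + m₀) := by
    have h2 : (X ^ J : ℤ[X]) * (f - u₁) i =
        (X ^ m : ℤ[X]) * g i +
          ((X ^ J : ℤ[X]) • f - (X ^ m : ℤ[X]) • g - (X ^ J : ℤ[X]) • u₁) i := by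
      simp only [Pi.sub_apply, Pi.smul_apply, smul_eq_mul]
      ring
    rw [h2]
    refine natDegree_add_le_of_degree_le ?_ ((hu i).trans (by lia))
    exact (natDegree_mul_le_of_le (natDegree_X_pow_le m) (hg i)).trans (by lia)
  by_cases h0 : (f - u₁) i = 0
  · simp [h0]
  · rw [natDegree_X_pow_mul _ h0] at h1
    lia

theorem exists_int_mul_eq {ι : Type*} [Fintype ι] (q : ι → ℚ) :
    ∃ N : ℕ, N ≠ 0 ∧ ∀ i, ∃ z : ℤ, (N : ℚ) * q i = z := by
  refine ⟨∏ i, (q i).den, Finset.prod_ne_zero_iff.2 fun i _ => (q i).den_ne_zero, fun i => ?_⟩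
  obtain ⟨c, hc⟩ := Finset.dvd_prod_of_mem (fun i => (q i).den) (Finset.mem_univ i)
  refine ⟨c * (q i).num, ?_⟩
  rw [hc]
  push_cast
  rw [mul_comm ((q i).den : ℚ), mul_assoc, mul_comm ((q i).den : ℚ), Rat.mul_den_eq_num]

/-- The elements of `ℤⁿ[A] ∩ A ^ m ℤⁿ[A⁻¹]` have a common denominator. -/
theorem exists_common_den (h : IsUnit A.det) (m : ℕ) : ∃ N : ℕ, N ≠ 0 ∧ ∀ z ∈ zAdjoin A,
    z ∈ filt A (-m) → ∃ v : Fin n → ℤ, ∀ i, (N : ℚ) * z i = v i := by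
  obtain ⟨K, hK⟩ := exists_bounded_polyEval A h m
  -- `N` clears the denominators of all entries of `A^0, …, A^K`, the only powers needed.
  obtain ⟨N, hN0, hN⟩ := exists_int_mul_eq
    fun t : Fin (K + 1) × Fin n × Fin n => (A ^ (t.1 : ℕ)) t.2.1 t.2.2
  refine ⟨N, hN0, fun z hz hz' => ?_⟩
  obtain ⟨f, hf, rfl⟩ := hK z hz hz'
  choose a ha using hN
  refine ⟨fun i => ∑ j, ∑ k : Fin (K + 1), (f j).coeff k * a (k, i, j), fun i => ?_⟩
  have h1 : ∀ j, aeval A (f j) = ∑ k : Fin (K + 1), (f j).coeff k • A ^ (k : ℕ) := by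
    intro j
    rw [aeval_eq_sum_range' (Nat.lt_succ_of_le (hf j)), Finset.sum_range]
  simp only [polyEval_apply, h1, mulHom, LinearMap.toAddMonoidHom_coe, Matrix.mulVecLin_apply,
    Finset.sum_apply, Matrix.mulVec_single_one, Matrix.col_apply, Matrix.sum_apply,
    Finset.mul_sum]
  push_cast
  refine Finset.sum_congr rfl fun j _ => Finset.sum_congr rfl fun k _ => ?_
  rw [← ha]
  simp only [Matrix.smul_apply, zsmul_eq_mul]
  ring

end

/-! ### The diagonal image of `ℤⁿ[A]`, and the measure -/

section
variable {n : ℕ} (A : Matrix (Fin n) (Fin n) ℚ) (hA : IsExpanding A)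

/-- The inclusion of `ℤⁿ[A]` into `ℤⁿ(B)`. -/
def toLaurent (x : zAdjoin A) : Laurent A hA := ⟨x.1, zAdjoin_le_zLaurent A x.2⟩

theorem digitEmb_add (x y : zAdjoin A) :
    digitEmb A hA (x + y) = digitEmb A hA x + digitEmb A hA y := by
  refine Prod.ext ?_ ?_
  · ext i
    exact Rat.cast_add _ _
  · exact UniformSpace.Completion.coe_add (toLaurent A hA x) (toLaurent A hA y)

theorem repMulHom_digitEmb (x : zAdjoin A) :
    repMulHom A hA (digitEmb A hA x) =
      digitEmb A hA ⟨mulHom A x, map_zAdjoin_le A ⟨x, x.2, rfl⟩⟩ := by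
  refine Prod.ext ?_ (seriesMul_coe A hA _)
  ext i
  change realMul A _ i = ((A.mulVec x.1 i : ℚ) : ℝ)
  simp [realMul_apply, Matrix.mulVec, dotProduct, digitEmb, diagEmb]

theorem norm_digitEmb_le_iff (x : zAdjoin A) (R : ℝ) :
    ‖digitEmb A hA x‖ ≤ R ↔
      ‖WithLp.toLp 2 (fun i => ((x.1 i : ℚ) : ℝ))‖ ≤ R ∧ bAbs A x.1 ≤ R := by
  rw [Prod.norm_def, max_le_iff]
  refine and_congr Iff.rfl ?_
  change ‖(toLaurent A hA x : BSeries A hA)‖ ≤ R ↔ _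
  rw [UniformSpace.Completion.norm_coe]
  rfl

/-- Choose `m` with `R < b^m`. If `b = 1` there are no jumps, every point of `ℤⁿ(B)` lies in every
step of the filtration, and `m = 0` will do. -/
theorem exists_mem_filt_of_bAbs_le (h : IsUnit A.det) (R : ℝ) :
    ∃ m : ℕ, ∀ y ∈ zLaurent A, bAbs A y ≤ R → y ∈ filt A (-m) := by
  by_cases hb : 2 ≤ residueCard A⁻¹
  · obtain ⟨m, hm⟩ := pow_unbounded_of_one_lt R
      (show (1 : ℝ) < residueCard A⁻¹ by exact_mod_cast hb)
    refine ⟨m, fun y hy hyR => (bAbs_le_iff h hy _).1 ?_⟩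
    rw [neg_neg, zpow_natCast]
    exact hyR.trans hm.le
  · exact ⟨0, fun y hy _ => mem_filt_of_no_jump h hy
      (fun ⟨_, hm⟩ => hb (two_le_of_isJump h hm)) _⟩

/-- The diagonal image of `ℤⁿ[A]` is locally finite. -/
theorem finite_digitEmb_ball (R : ℝ) :
    {p ∈ Set.range (digitEmb A hA) | ‖p‖ ≤ R}.Finite := by
  obtain ⟨m, hm⟩ := exists_mem_filt_of_bAbs_le A hA.isUnit_det R
  obtain ⟨N, hN0, hN⟩ := exists_common_den A hA.isUnit_det m
  have hN0' : (N : ℚ) ≠ 0 := by exact_mod_cast hN0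
  have h1 : {z : zAdjoin A | ‖digitEmb A hA z‖ ≤ R}.Finite := by
    -- The `B`-adic bound fixes the denominator `N`, the real bound confines the numerators to a
    -- box.
    have h2 : ((fun (v : Fin n → ℤ) i => (v i : ℚ) / N) ''
        Set.Icc (fun _ => -⌈N * R⌉) (fun _ => ⌈N * R⌉)).Finite := (Set.finite_Icc _ _).image _
    refine (h2.preimage Subtype.val_injective.injOn).subset ?_
    intro z hz
    obtain ⟨hz1, hz2⟩ := (norm_digitEmb_le_iff A hA z R).1 hz
    obtain ⟨v, hv⟩ := hN z z.2 (hm z (zAdjoin_le_zLaurent A z.2) hz2)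
    have h3 : ∀ i, |v i| ≤ ⌈N * R⌉ := by
      intro i
      have h4 : |((z.1 i : ℚ) : ℝ)| ≤ R :=
        (PiLp.norm_apply_le (WithLp.toLp 2 (fun i => ((z.1 i : ℚ) : ℝ))) i).trans hz1
      have h5 : (N : ℝ) * ((z.1 i : ℚ) : ℝ) = v i := by exact_mod_cast hv i
      have h6 : |(v i : ℝ)| ≤ N * R := by
        rw [← h5, abs_mul, Nat.abs_cast]
        gcongr
      have h7 := h6.trans (Int.le_ceil _)
      exact_mod_cast h7
    refine ⟨v, ⟨fun i => (abs_le.1 (h3 i)).1, fun i => (abs_le.1 (h3 i)).2⟩, ?_⟩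
    ext i
    simp only [← hv]
    field_simp
  refine (h1.image (digitEmb A hA)).subset ?_
  rintro _ ⟨⟨z, rfl⟩, hz⟩
  exact ⟨z, hz, rfl⟩

theorem zLaurent_le_sup (h : IsUnit A.det) : zLaurent A ≤ zAdjoin A ⊔ zAdjoin A⁻¹ := by
  refine iSup_le fun k => ?_
  rcases Int.eq_nat_or_neg k with ⟨j, rfl | rfl⟩
  · rw [zpow_natCast]
    exact (le_iSup (fun k : ℕ => (intLattice n).map (mulHom (A ^ k))) j).trans le_sup_left
  · rw [← Matrix.inv_zpow' h, zpow_natCast]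
    exact (le_iSup (fun k : ℕ => (intLattice n).map (mulHom (A⁻¹ ^ k))) j).trans le_sup_right

theorem bAbs_le_one_of_mem (h : IsUnit A.det) {y : Fin n → ℚ} (hy : y ∈ zLaurent A)
    (hy' : y ∈ zAdjoin A⁻¹) : bAbs A y ≤ 1 := by
  simpa using (bAbs_le_iff h hy 0).2 (by rwa [filt_zero])

/-- The diagonal image of `ℤⁿ[A]` is relatively dense. -/
theorem exists_digitEmb_near (p : RepSpace A hA) :
    ∃ x ∈ Set.range (digitEmb A hA), ‖p - x‖ ≤ n + 3 := by
  have hdet := hA.isUnit_det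
  obtain ⟨x, y⟩ := p
  have hd : DenseRange ((↑) : Laurent A hA → BSeries A hA) :=
    UniformSpace.Completion.denseRange_coe
  obtain ⟨y', hy'⟩ := hd.exists_dist_lt y one_pos
  -- `z` is `B`-adically close to `y'`, as `w` is integral. The real coordinate is then corrected by
  -- an integer vector, which lies in `ℤⁿ[A]` and, being in `ℤⁿ[A⁻¹]` too, does no `B`-adic harm.
  obtain ⟨z, hz, w, hw, hzw⟩ := AddSubgroup.mem_sup.1 (zLaurent_le_sup A hdet y'.2)
  set v : Fin n → ℤ := fun i => ⌊x i - z i⌋ with hv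
  have hv' : (Int.castAddHom ℚ).compLeft (Fin n) v ∈ intLattice n := ⟨v, rfl⟩
  set u := (Int.castAddHom ℚ).compLeft (Fin n) v
  have hu : u ∈ zAdjoin A := intLattice_le_zAdjoin A hv'
  refine ⟨_, ⟨⟨z, hz⟩ + ⟨u, hu⟩, rfl⟩, ?_⟩
  rw [Prod.norm_def]
  refine max_le ?_ ?_
  · have h1 : ∀ i, ‖(x - WithLp.toLp 2 fun i => (((z + u) i : ℚ) : ℝ)) i‖ ≤ 1 := by
      intro i
      have h2 : (x - WithLp.toLp 2 fun i => (((z + u) i : ℚ) : ℝ)) i = Int.fract (x i - z i) := by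
        change x i - ((z i + (v i : ℚ) : ℚ) : ℝ) = _
        rw [← Int.self_sub_floor, hv]
        push_cast
        ring
      rw [h2, Real.norm_eq_abs, Int.abs_fract]
      exact (Int.fract_lt_one _).le
    have h3 : ‖x - WithLp.toLp 2 fun i => (((z + u) i : ℚ) : ℝ)‖ ≤ n := by
      rw [EuclideanSpace.norm_eq]
      refine Real.sqrt_le_iff.2 ⟨Nat.cast_nonneg _, ?_⟩
      have h5 : ∑ i, ‖(x - WithLp.toLp 2 fun i => (((z + u) i : ℚ) : ℝ)) i‖ ^ 2 ≤
          ∑ _i : Fin n, 1 := Finset.sum_le_sum fun i _ => pow_le_one₀ (norm_nonneg _) (h1 i)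
      refine h5.trans ?_
      simp only [Finset.sum_const, Finset.card_univ, Fintype.card_fin, nsmul_eq_mul, mul_one]
      exact_mod_cast Nat.le_self_pow two_ne_zero n
    change ‖x - WithLp.toLp 2 fun i => (((z + u) i : ℚ) : ℝ)‖ ≤ _
    linarith
  · have hzl := zAdjoin_le_zLaurent A hz
    have hul := zAdjoin_le_zLaurent A hu
    set t : Laurent A hA := ⟨z + u, add_mem hzl hul⟩
    change ‖y - (t : BSeries A hA)‖ ≤ _
    have hwl : w ∈ zLaurent A := by
      rw [← add_sub_cancel_left z w, hzw]
      exact sub_mem y'.2 hzl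
    have h6 : ‖y' - t‖ ≤ 1 := by
      rw [norm_def]
      change bAbs A (y'.1 - (z + u)) ≤ 1
      rw [← hzw, add_sub_add_left_eq_sub]
      exact bAbs_le_one_of_mem A hdet (sub_mem hwl hul)
        (sub_mem hw (intLattice_le_zAdjoin _ hv'))
    have h7 : ‖(y' : BSeries A hA) - (t : BSeries A hA)‖ ≤ 1 := by
      rwa [← UniformSpace.Completion.coe_sub, UniformSpace.Completion.norm_coe]
    rw [dist_eq_norm] at hy'
    have h8 := norm_add_le (y - (y' : BSeries A hA)) ((y' : BSeries A hA) - (t : BSeries A hA))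
    rw [sub_add_sub_cancel] at h8
    have : (0 : ℝ) ≤ n := Nat.cast_nonneg n
    linarith

/-- Countability makes the completion second countable; with local compactness, its Haar measure is
σ-finite and behaves well in products. -/
instance : Countable (Laurent A hA) := inferInstanceAs (Countable (zLaurent A))

instance : SecondCountableTopology (BSeries A hA) := UniformSpace.secondCountable_of_separable _

instance : LocallyCompactSpace (BSeries A hA) :=
  (integralCompacts A hA).locallyCompactSpace_of_addGroup

instance : Measure.IsAddHaarMeasure (seriesMeasure A hA) :=
  inferInstanceAs (Measure.IsAddHaarMeasure (Measure.addHaarMeasure (integralCompacts A hA)))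

instance : Measure.IsAddLeftInvariant (repMeasure A hA) :=
  inferInstanceAs (Measure.IsAddLeftInvariant
    ((volume : Measure (EuclideanSpace ℝ (Fin n))).prod (seriesMeasure A hA)))

instance : Measure.IsOpenPosMeasure (repMeasure A hA) :=
  inferInstanceAs (Measure.IsOpenPosMeasure
    ((volume : Measure (EuclideanSpace ℝ (Fin n))).prod (seriesMeasure A hA)))

/-- A set with countably many translates that cover the representation space has positive
measure. -/
theorem repMeasure_pos_of_cover {F : Set (RepSpace A hA)} {Λ : Set (RepSpace A hA)}
    (hΛ : Λ.Countable) (hF : ⋃ x ∈ Λ, (fun p => p + x) '' F = Set.univ) :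
    0 < repMeasure A hA F := by
  refine pos_iff_ne_zero.2 fun h0 => ?_
  refine isOpen_univ.measure_ne_zero (repMeasure A hA) Set.univ_nonempty ?_
  rw [← hF, measure_biUnion_null_iff hΛ]
  intro x _
  rw [Set.image_add_right, measure_preimage_add_right, h0]

/-- Division with remainder in `ℤⁿ[A]`, which makes the union of translates stable under `A⁻¹`. -/
theorem exists_digit_sub_mem {A : Matrix (Fin n) (Fin n) ℚ} {D : Finset (zAdjoin A)}
    (hD : IsStandardDigitSystem A D) (x : zAdjoin A) :
    ∃ d ∈ D, ∃ y : zAdjoin A,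
      x = ⟨mulHom A y, map_zAdjoin_le A ⟨y, y.2, rfl⟩⟩ + d := by
  obtain ⟨d, ⟨hd, hdx⟩, -⟩ := hD.complete (QuotientAddGroup.mk x)
  obtain ⟨y, hy, hyx⟩ := QuotientAddGroup.eq.1 hdx
  refine ⟨d, hd, ⟨y, hy⟩, Subtype.ext ?_⟩
  change x.1 = mulHom A y + d.1
  rw [hyx]
  change x.1 = -d.1 + x.1 + d.1
  abel

theorem repMulHom_set_eq_iff [DecidableEq (RepSpace A hA)] (D : Finset (zAdjoin A))
    (F : Set (RepSpace A hA)) :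
    repMul A hA '' F = ⋃ d ∈ D, (fun p => p + digitEmb A hA d) '' F ↔
      repMulHom A hA '' F = ⋃ d ∈ D.image (digitEmb A hA), (fun p => p + d) '' F := by
  rw [Finset.set_biUnion_finset_image]
  rfl

theorem IsStandardDigitSystem.nonempty {A : Matrix (Fin n) (Fin n) ℚ} {D : Finset (zAdjoin A)}
    (hD : IsStandardDigitSystem A D) : D.Nonempty :=
  let ⟨d, hd, _⟩ := exists_digit_sub_mem hD 0
  ⟨d, hd⟩

end

end RationalTile

open RationalTile in
theorem mainTheorem6 (n : ℕ) (A : Matrix (Fin n) (Fin n) ℚ)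
    (D : Finset (RationalTile.zAdjoin A)) (hD : RationalTile.IsStandardDigitSystem A D) :
    ∃ F : Set (RationalTile.RepSpace A hD.expanding),
      (RationalTile.IsSelfAffineSet A hD.expanding D F ∧
        ∀ F', RationalTile.IsSelfAffineSet A hD.expanding D F' → F' = F) ∧
      0 < RationalTile.repMeasure A hD.expanding F := by
  classical
  have hA := hD.expanding
  obtain ⟨c, hc0, hc, hcb⟩ := hA.exists_summable
  have hT := norm_repInvMul_iterate_le A hA hc0 hcb
  have hC0 : ∀ k, 0 ≤ n * c k + (1 / 2) ^ k := fun k =>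
    add_nonneg (mul_nonneg (Nat.cast_nonneg _) (hc0 k)) (by positivity)
  have hC : Summable fun k => n * c k + (1 / 2) ^ k :=
    (hc.mul_left _).add (summable_geometric_of_lt_one (by norm_num) (by norm_num))
  have hTM := repInvMul_leftInverse A hA
  have hMT := repInvMul_rightInverse A hA
  set Φ := D.image (digitEmb A hA) with hΦ
  -- The class of 0 has a representative, so digit sequences exist.
  have : Nonempty Φ := (hD.nonempty.image _).to_subtype
  have hne : (Set.range (digitSum (repInvMul A hA) Φ)).Nonempty := Set.range_nonempty _
  have hcpt := isCompact_range (continuous_digitSum hT hC0 hC Φ)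
  have hF := range_digitSum_set_eq hT hC0 hC hMT Φ
  refine ⟨Set.range (digitSum (repInvMul A hA) Φ),
    ⟨⟨hne, hcpt, (repMulHom_set_eq_iff A hA D _).2 hF⟩, fun F' hF' => ?_⟩, ?_⟩
  · exact eq_range_digitSum hT hC0 hC hTM hMT hF'.nonempty hF'.isCompact
      ((repMulHom_set_eq_iff A hA D F').1 hF'.set_eq)
  · refine repMeasure_pos_of_cover A hA (Set.countable_range (digitEmb A hA))
      (iUnion_translate_eq_univ hT hC0 hC hTM hMT hne hcpt hF ?_ (finite_digitEmb_ball A hA)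
        (exists_digitEmb_near A hA))
    rintro _ ⟨x, rfl⟩
    obtain ⟨d, hd, y, hxy⟩ := exists_digit_sub_mem hD x
    refine ⟨_, Finset.mem_image_of_mem _ hd, _, ⟨y, rfl⟩, ?_⟩
    rw [repMulHom_digitEmb, ← digitEmb_add, ← hxy]
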